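/- Let $\Omega$ be a compact Hausdorff space and let $B(\Omega)$ be the space of real-valued Borel functions on $\Omega$. Let $\|\cdot\|_X:B(\Omega)\to[0,\infty]$ be an admissible quasinorm, i.e.: (a) $\|f\|_X\le\|g\|_X$ whenever $|f|\le|g|$ pointwise; (b) $\|\alpha f\|_X=|\alpha|\,\|f\|_X$ for $\alpha\in\mathbb R$ (with $0\cdot\infty=0$); (c) there is a constant $C$ with $\|f+g\|_X\le C(\|f\|_X+\|g\|_X)$ whenever $f,g\ge 0$ have disjoint supports; (d) there is a strictly positive $u$ with $0<\|u\|_X<\infty$; (e) if $f_n\ge 0$ and $f_n\uparrow f$ pointwise, then $\|f_n\|_X\to\|f\|_X$. Let $X=\{f\in B(\Omega):\|f\|_X<\infty\}$ and $0<p<q<\infty$. Suppose that for all $n$ and all $f_1,\dots,f_n\in X$ with pairwise disjoint supports $$\|f_1+\cdots+f_n\|_X\le a\Big(\sum_{i=1}^n\|f_i\|_X^p\Big)^{1/p}\quad\text{and}\quad \Big(\sum_{i=1}^n\|f_i\|_X^q\Big)^{1/q}\le b\,\|f_1+\cdots+f_n\|_X$$ (a crude upper $p$-estimate with constant $a$ and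 a crude lower $q$-estimate with constant $b$). For $r>0$ put $K_r=2(2^r-1)^{-1/r}-1$. For a finite Borel measure $\mu$ on $\Omega$, $h\in B(\Omega)$ and $s,t>0$ put $$\|h\|_{\Lambda_{s,t}(\mu)}=\sup\Big(\sum_{i=1}^n(\inf_{A_i}|h|)^t\mu(A_i)^{t/s}\Big)^{1/t}\ (s<t),\qquad \|h\|_{\Lambda_{s,t}(\mu)}=\inf\Big(\sum_{i=1}^n(\sup_{A_i}|h|)^t\mu(A_i)^{t/s}\Big)^{1/t}\ (s>t),$$ the supremum and infimum being over all finite Borel partitions $\{A_1,\dots,A_n\}$ of $\Omega$, with $\infty\cdot 0=0$. These quantities do not depend on the values of $h$ on a $\mu$-null set. **Proposition 3.5.** Let $f\in X$, $f\ge 0$, $\|f\|_X=1$. Then: (i) there is a Borel probability measure $\mu$ on $\Omega$ such that $f>0$ $\mu$-a.e. and, for every $g\in X$, $$\|gf^{-1}\|_{\Lambda_{p,q}(\mu)}\le ab\,K_{q/p}^{-1/p}\,\|g\|_X;$$ (ii) there is a Borel probability measure $\lambda$ on $\Omega$ such that $f>0$ $\lambda$-a.e. and, for every $g\in X$ that vanishes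 on $\{f=0\}$ in the sense that $\|g\chi_{\{f=0\}}\|_X=0$ (every $g\in X$, if $f$ is strictly positive), $$\|g\|_X\le ab\,K_{p/q}^{1/q}\,\|gf^{-1}\|_{\Lambda_{q,p}(\lambda)}.$$ Here $gf^{-1}$ is given the value $0$ where $f=0$, which is a null set for $\mu$ and for $\lambda$. -/

import Mathlib

open Set Filter Topology MeasureTheory
open scoped ENNReal NNReal

/-- An admissible extended-value quasinorm on the space of real-valued Borel functions on `Ω`.
Only the values of `N` at measurable (Borel) functions matter; the associated quasi-Banach function
space is `X = {f Borel | N f < ∞}`. -/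
structure IsAdmissibleQuasinorm {Ω : Type*} [MeasurableSpace Ω] (N : (Ω → ℝ) → ℝ≥0∞) : Prop where
  mono : ∀ f g : Ω → ℝ, Measurable f → Measurable g → (∀ ω, |f ω| ≤ |g ω|) → N f ≤ N g
  smul : ∀ (α : ℝ) (f : Ω → ℝ), Measurable f →
    N (fun ω => α * f ω) = ENNReal.ofReal |α| * N f
  quasi_add : ∃ C : ℝ≥0, ∀ f g : Ω → ℝ, Measurable f → Measurable g →
    (∀ ω, 0 ≤ f ω) → (∀ ω, 0 ≤ g ω) → Disjoint (Function.support f) (Function.support g) →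
    N (f + g) ≤ C * (N f + N g)
  exists_pos : ∃ u : Ω → ℝ, Measurable u ∧ (∀ ω, 0 < u ω) ∧ 0 < N u ∧ N u < ∞
  fatou : ∀ (f : ℕ → Ω → ℝ) (g : Ω → ℝ), (∀ n, Measurable (f n)) → Measurable g →
    (∀ n ω, 0 ≤ f n ω) → (∀ ω, Monotone fun n => f n ω) →
    (∀ ω, Tendsto (fun n => f n ω) atTop (𝓝 (g ω))) →
    Tendsto (fun n => N (f n)) atTop (𝓝 (N g))

/-- The function space `{f | N f < ∞}` satisfies a crude upper `p`-estimate with constant `a`. -/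
def CrudeUpperEstimate {Ω : Type*} [MeasurableSpace Ω] (N : (Ω → ℝ) → ℝ≥0∞)
    (p : ℝ) (a : ℝ≥0) : Prop :=
  ∀ (n : ℕ) (f : Fin n → Ω → ℝ), (∀ i, Measurable (f i)) → (∀ i, N (f i) < ∞) →
    (Pairwise fun i j => Disjoint (Function.support (f i)) (Function.support (f j))) →
    N (∑ i, f i) ≤ a * (∑ i, N (f i) ^ p) ^ (1 / p)

/-- The function space `{f | N f < ∞}` satisfies a crude lower `q`-estimate with constant `b`. -/
def CrudeLowerEstimate {Ω : Type*} [MeasurableSpace Ω] (N : (Ω → ℝ) → ℝ≥0∞)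
    (q : ℝ) (b : ℝ≥0) : Prop :=
  ∀ (n : ℕ) (f : Fin n → Ω → ℝ), (∀ i, Measurable (f i)) → (∀ i, N (f i) < ∞) →
    (Pairwise fun i j => Disjoint (Function.support (f i)) (Function.support (f j))) →
    (∑ i, N (f i) ^ q) ^ (1 / q) ≤ b * N (∑ i, f i)

/-- The constant `K_r = 2 / (2 ^ r - 1) ^ (1 / r) - 1`, for `0 < r < ∞`. -/
noncomputable def kConst (r : ℝ) : ℝ := 2 / ((2 : ℝ) ^ r - 1) ^ (1 / r) - 1

/-- `A 0, …, A (n - 1)` is a finite Borel partition of `Ω`. Empty pieces are allowed; they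
contribute `0` to the sums below. -/
structure IsBorelPartition {Ω : Type*} [MeasurableSpace Ω] {n : ℕ} (A : Fin n → Set Ω) : Prop where
  measurableSet : ∀ i, MeasurableSet (A i)
  pairwise_disjoint : Pairwise fun i j => Disjoint (A i) (A j)
  iUnion_eq : ⋃ i, A i = univ

open Classical in
/-- The functional `‖f‖_{Λ_{p,q}(μ)}`. It is the supremum over finite Borel partitions of
`(∑ (inf_{A_i} |f|)^q μ(A_i)^(q/p))^(1/q)` if `p < q`, and the infimum over finite Borel partitions
of `(∑ (sup_{A_i} |f|)^q μ(A_i)^(q/p))^(1/q)` if `p > q` (the case `p = q` is not used). All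
quantities are in `[0, ∞]`, with `∞ * 0 = 0`. -/
noncomputable def lambdaNorm {Ω : Type*} [MeasurableSpace Ω] (p q : ℝ) (μ : Measure Ω)
    (f : Ω → ℝ) : ℝ≥0∞ :=
  if p < q then
    ⨆ (n : ℕ) (A : Fin n → Set Ω) (_ : IsBorelPartition A),
      (∑ i, (⨅ ω ∈ A i, ENNReal.ofReal |f ω|) ^ q * μ (A i) ^ (q / p)) ^ (1 / q)
  else
    ⨅ (n : ℕ) (A : Fin n → Set Ω) (_ : IsBorelPartition A),
      (∑ i, (⨆ ω ∈ A i, ENNReal.ofReal |f ω|) ^ q * μ (A i) ^ (q / p)) ^ (1 / q)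

/-! Put s = q/p and Φ_g(A) = N(g 1_A)^p. The upper p-estimate makes Φ_g subadditive over partitions
up to the factor c = a^p; the lower q-estimate gives (∑ Φ_g(A_i)^s)^(1/s) ≤ d Φ_g(B) with d = b^p.
Each constant is removed by a hull: the supremum of ∑ Φ^s over partitions, raised to 1/s, makes the
lower estimate exact, and the infimum of ∑ Φ makes subadditivity exact. By Minkowski's inequality in
ℓ^s each hull keeps the constant of the other estimate (`CrudelySubadditive.supHull`,
`CrudelySuperadditive.infHull`), so applying both to Φ_f gives an exact submeasure χ with χ^s
superadditive.

Such a χ dominates a measure of mass at least K_s χ(Ω), and χ^s is dominated by a measure of mass at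
most K_{1/s} χ(Ω)^s. On a finite set this is an extremal argument (`exists_large_dominatedWeights`,
`exists_small_dominatingWeights`). Compactness of the finitely additive set functions with values in
[0, ∞] carries it to Ω, and `IsFinitelyAdditive.exists_measure_le` extracts a countably additive
part. The needed mass survives because the lower estimate makes A ↦ N(f 1_A) order continuous
(`iInf_indicator_rpow_eq_zero`).

On a piece A_i of a partition, |g| lies between inf |g/f| and sup |g/f| times f, up to the zeros of
f. Thus a comparison of the measure with Φ_f becomes a comparison with Φ_g, and the remaining crude
estimate, applied to g, sums the pieces. Part (i) takes the supremum hull first and part (ii) the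
infimum hull first, matching the two forms of the Λ-functional. -/

/-! ### The constants K_r. -/

section Constants

/-- The number `y` with `y ^ s + (1 / 2) ^ s = 1`. -/
noncomputable def halfDual (s : ℝ) : ℝ := (1 - (1 / 2 : ℝ) ^ s) ^ (1 / s)

lemma half_rpow_lt_one {s : ℝ} (hs : 0 < s) : (1 / 2 : ℝ) ^ s < 1 :=
  Real.rpow_lt_one (by norm_num) (by norm_num) hs

lemma halfDual_pos {s : ℝ} (hs : 0 < s) : 0 < halfDual s :=
  Real.rpow_pos_of_pos (sub_pos.2 (half_rpow_lt_one hs)) _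

lemma halfDual_rpow {s : ℝ} (hs : 0 < s) : halfDual s ^ s = 1 - (1 / 2 : ℝ) ^ s := by
  rw [halfDual, one_div s, Real.rpow_inv_rpow (sub_pos.2 (half_rpow_lt_one hs)).le hs.ne']

lemma halfDual_lt_one {s : ℝ} (hs : 0 < s) : halfDual s < 1 := by
  have h : halfDual s ^ s < 1 ^ s := by
    rw [halfDual_rpow hs, Real.one_rpow]
    linarith [Real.rpow_pos_of_pos (show (0 : ℝ) < 1 / 2 by norm_num) s]
  exact (Real.rpow_lt_rpow_iff (halfDual_pos hs).le zero_le_one hs).1 h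

/-- With y = `halfDual s`, comparing a ratio K with K_s amounts to comparing 1/(1 + K) with y; the
extremal arguments use the constant in this form. -/
lemma kConst_eq {s : ℝ} (hs : 0 < s) : kConst s = 1 / halfDual s - 1 := by
  have h2 : (0 : ℝ) < 2 ^ s := by positivity
  have h1 : (1 : ℝ) < 2 ^ s := Real.one_lt_rpow (by norm_num) hs
  have : (1 - (1 / 2 : ℝ) ^ s) = (2 ^ s - 1) / 2 ^ s := by
    rw [Real.div_rpow (by norm_num) (by norm_num), Real.one_rpow]; field_simp
  rw [kConst, halfDual, this, Real.div_rpow (by linarith) h2.le, ← Real.rpow_mul (by norm_num),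
    mul_one_div_cancel hs.ne', Real.rpow_one, one_div_div]

lemma kConst_pos {s : ℝ} (hs : 0 < s) : 0 < kConst s := by
  rw [kConst_eq hs, sub_pos]
  exact (one_lt_div (halfDual_pos hs)).2 (halfDual_lt_one hs)

end Constants

/-! ### Two-term convexity and Hölder inequalities. -/

section Convexity

/-- Convexity of (x, y) ↦ x^s + y^s on the segment from (0, 1), where its value is 1, to (p, q). It
serves to slide a point along the segment until one coordinate is 1/2. -/
lemma convex_comb_rpow_le {s l p q : ℝ} (hs : 1 ≤ s) (hl : 0 ≤ l) (hl1 : l ≤ 1) (hp : 0 ≤ p)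
    (hq : 0 ≤ q) : (l * p) ^ s + ((1 - l) + l * q) ^ s ≤ (1 - l) + l * (p ^ s + q ^ s) := by
  have h0 : (0 : ℝ) ^ s = 0 := Real.zero_rpow (by linarith)
  have h1 := (convexOn_rpow hs).2 (x := 0) (y := p) (by simp) hp (sub_nonneg.2 hl1) hl (by ring)
  have h2 := (convexOn_rpow hs).2 (x := 1) (y := q) (by simp) hq (sub_nonneg.2 hl1) hl (by ring)
  simp only [smul_eq_mul, h0, mul_zero, zero_add, Real.one_rpow, mul_one] at h1 h2
  linarith

lemma le_concave_comb_rpow {s l p q : ℝ} (hs0 : 0 < s) (hs : s ≤ 1) (hl : 0 ≤ l) (hl1 : l ≤ 1)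
    (hp : 0 ≤ p) (hq : 0 ≤ q) :
    (1 - l) + l * (p ^ s + q ^ s) ≤ (l * p) ^ s + ((1 - l) + l * q) ^ s := by
  have h0 : (0 : ℝ) ^ s = 0 := Real.zero_rpow hs0.ne'
  have h1 := (Real.concaveOn_rpow hs0.le hs).2 (x := 0) (y := p) (by simp) hp
    (sub_nonneg.2 hl1) hl (by ring)
  have h2 := (Real.concaveOn_rpow hs0.le hs).2 (x := 1) (y := q) (by simp) hq
    (sub_nonneg.2 hl1) hl (by ring)
  simp only [smul_eq_mul, h0, mul_zero, zero_add, Real.one_rpow, mul_one] at h1 h2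
  linarith

/-- Hölder's inequality for two summands, with the extremal weights. -/
lemma exists_dual_weights {s u v : ℝ} (hs : 1 ≤ s) (hu : 0 < u) (hv : 0 < v) :
    ∃ α β : ℝ, 0 ≤ α ∧ 0 ≤ β ∧ (α * u + β * v) ^ s = u ^ s + v ^ s ∧
      ∀ a b : ℝ, 0 ≤ a → 0 ≤ b → (α * a + β * b) ^ s ≤ a ^ s + b ^ s := by
  have hs0 : 0 < s := by linarith
  have hus : 0 < u ^ s := Real.rpow_pos_of_pos hu s
  have hvs : 0 < v ^ s := Real.rpow_pos_of_pos hv s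
  have hU : 0 < u ^ s + v ^ s := by positivity
  have hN : 0 ≤ (u ^ s + v ^ s) ^ (1 / s) := by positivity
  have hNs : ((u ^ s + v ^ s) ^ (1 / s)) ^ s = u ^ s + v ^ s := by
    rw [one_div, Real.rpow_inv_rpow hU.le hs0.ne']
  set U := u ^ s + v ^ s with hUdef
  set N := U ^ (1 / s)
  have hsum : u ^ s / U + v ^ s / U = 1 := by rw [← add_div, div_self hU.ne']
  -- With these weights αa + βb is N times the average of a/u and b/v with masses u^s/U and v^s/U,
  -- so Jensen's inequality for t^s applies.
  refine ⟨N * (u ^ s / U) / u, N * (v ^ s / U) / v, by positivity, by positivity, ?_, ?_⟩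
  · rw [div_mul_cancel₀ _ hu.ne', div_mul_cancel₀ _ hv.ne', ← mul_add, hsum, mul_one, hNs]
  · intro a b ha hb
    have h := (convexOn_rpow hs).2 (x := a / u) (y := b / v) (div_nonneg ha hu.le)
      (div_nonneg hb hv.le) (show 0 ≤ u ^ s / U by positivity)
      (show 0 ≤ v ^ s / U by positivity) hsum
    simp only [smul_eq_mul, Real.div_rpow ha hu.le, Real.div_rpow hb hv.le] at h
    have e : N * (u ^ s / U) / u * a + N * (v ^ s / U) / v * b
        = N * (u ^ s / U * (a / u) + v ^ s / U * (b / v)) := by ring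
    rw [e, Real.mul_rpow hN (by positivity), hNs]
    calc _ ≤ U * _ := mul_le_mul_of_nonneg_left h hU.le
      _ = a ^ s + b ^ s := by field_simp

/-- The reverse Hölder inequality for two summands, with the extremal weights. -/
lemma exists_reverse_dual_weights {s u v : ℝ} (hs0 : 0 < s) (hs : s ≤ 1) (hu : 0 ≤ u)
    (hv : 0 ≤ v) :
    ∃ α β : ℝ, 0 ≤ α ∧ 0 ≤ β ∧ (α * u + β * v) ^ s = u ^ s + v ^ s ∧
      ∀ a b : ℝ, 0 ≤ a → a ≤ u → 0 ≤ b → b ≤ v → a ^ s + b ^ s ≤ (α * a + β * b) ^ s := by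
  -- The bounds a ≤ u and b ≤ v matter only in the degenerate cases, where they force a or b to
  -- vanish.
  rcases hu.eq_or_lt with rfl | hu
  · refine ⟨0, 1, le_rfl, zero_le_one, by simp [Real.zero_rpow hs0.ne'], fun a b ha ha' _ _ => ?_⟩
    obtain rfl := le_antisymm ha' ha
    simp [Real.zero_rpow hs0.ne']
  rcases hv.eq_or_lt with rfl | hv
  · refine ⟨1, 0, zero_le_one, le_rfl, by simp [Real.zero_rpow hs0.ne'], fun a b _ _ hb hb' => ?_⟩
    obtain rfl := le_antisymm hb' hb
    simp [Real.zero_rpow hs0.ne']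
  have hus : 0 < u ^ s := Real.rpow_pos_of_pos hu s
  have hvs : 0 < v ^ s := Real.rpow_pos_of_pos hv s
  have hU : 0 < u ^ s + v ^ s := by positivity
  have hN : 0 ≤ (u ^ s + v ^ s) ^ (1 / s) := by positivity
  have hNs : ((u ^ s + v ^ s) ^ (1 / s)) ^ s = u ^ s + v ^ s := by
    rw [one_div, Real.rpow_inv_rpow hU.le hs0.ne']
  set U := u ^ s + v ^ s with hUdef
  set N := U ^ (1 / s)
  have hsum : u ^ s / U + v ^ s / U = 1 := by rw [← add_div, div_self hU.ne']
  refine ⟨N * (u ^ s / U) / u, N * (v ^ s / U) / v, by positivity, by positivity, ?_, ?_⟩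
  · rw [div_mul_cancel₀ _ hu.ne', div_mul_cancel₀ _ hv.ne', ← mul_add, hsum, mul_one, hNs]
  · intro a b ha _ hb _
    have h := (Real.concaveOn_rpow hs0.le hs).2 (x := a / u) (y := b / v) (div_nonneg ha hu.le)
      (div_nonneg hb hv.le) (show 0 ≤ u ^ s / U by positivity)
      (show 0 ≤ v ^ s / U by positivity) hsum
    simp only [smul_eq_mul, Real.div_rpow ha hu.le, Real.div_rpow hb hv.le] at h
    have e : N * (u ^ s / U) / u * a + N * (v ^ s / U) / v * b
        = N * (u ^ s / U * (a / u) + v ^ s / U * (b / v)) := by ring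
    rw [e, Real.mul_rpow hN (by positivity), hNs]
    calc a ^ s + b ^ s = U * _ := by field_simp
      _ ≤ _ := mul_le_mul_of_nonneg_left h hU.le

end Convexity

/-! ### Submeasures on a finite set: large dominated measures. -/

section FiniteSubmeasure

/-- The weights on a finite set whose total over every subset is dominated by `χ`. -/
def dominatedWeights {J : Type*} (χ : Finset J → ℝ) : Set (J → ℝ) :=
  {w | (∀ j, 0 ≤ w j) ∧ ∀ T, ∑ j ∈ T, w j ≤ χ T}

lemma exists_max_dominatedWeights {J : Type*} (χ : Finset J → ℝ) (h0 : ∀ T, 0 ≤ χ T) (E : Finset J) :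
    ∃ w ∈ dominatedWeights χ, ∀ v ∈ dominatedWeights χ, ∑ j ∈ E, v j ≤ ∑ j ∈ E, w j := by
  have hc : IsCompact (dominatedWeights χ) := by
    refine (isCompact_Icc (a := (0 : J → ℝ)) (b := fun j => χ {j})).of_isClosed_subset ?_ ?_
    · have : dominatedWeights χ
          = (⋂ j, {w : J → ℝ | 0 ≤ w j}) ∩ ⋂ T, {w : J → ℝ | ∑ j ∈ T, w j ≤ χ T} := by
        ext w; simp [dominatedWeights]
      rw [this]
      exact (isClosed_iInter fun j => isClosed_le continuous_const (continuous_apply j)).inter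
        (isClosed_iInter fun T => isClosed_le (by fun_prop) continuous_const)
    · exact fun w hw => ⟨hw.1, fun j => by simpa using hw.2 {j}⟩
  have hne : (dominatedWeights χ).Nonempty := ⟨0, by simp, fun T => by simpa using h0 T⟩
  exact hc.exists_isMaxOn hne
    (f := fun w : J → ℝ => ∑ j ∈ E, w j) (by fun_prop)

lemma finset_monotone_of_superadditive_rpow {J : Type*} [DecidableEq J] {χ : Finset J → ℝ} {s : ℝ} (hs : 0 < s)
    (h0 : ∀ T, 0 ≤ χ T)
    (hsup : ∀ T U, Disjoint T U → χ T ^ s + χ U ^ s ≤ χ (T ∪ U) ^ s) {T U : Finset J}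
    (h : T ⊆ U) : χ T ≤ χ U := by
  have h1 := hsup T (U \ T) Finset.disjoint_sdiff
  rw [Finset.union_sdiff_of_subset h] at h1
  exact (Real.rpow_le_rpow_iff (h0 _) (h0 _) hs).1
    (by linarith [Real.rpow_nonneg (h0 (U \ T)) s])

/-- Glue α w₁ on H to β w₂ on D with the extremal Hölder weights: equality in Hölder gives the mass
on H ∪ D, while the inequality and the superadditivity of χ^s keep the glued weights below χ. Hence
the maximal dominated mass inherits the lower s-estimate. -/
lemma dominatedWeights_superadditive {J : Type*} [DecidableEq J] {χ : Finset J → ℝ} {s : ℝ} (hs : 1 ≤ s) (h0 : ∀ T, 0 ≤ χ T)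
    (hsup : ∀ T U, Disjoint T U → χ T ^ s + χ U ^ s ≤ χ (T ∪ U) ^ s)
    {H D : Finset J} (hHD : Disjoint H D) {w₁ w₂ : J → ℝ} (h₁ : w₁ ∈ dominatedWeights χ)
    (h₂ : w₂ ∈ dominatedWeights χ) :
    ∃ w ∈ dominatedWeights χ,
      (∑ j ∈ H, w₁ j) ^ s + (∑ j ∈ D, w₂ j) ^ s ≤ (∑ j ∈ H ∪ D, w j) ^ s := by
  have hs0 : 0 < s := by linarith
  have hu := Finset.sum_nonneg fun j (_ : j ∈ H) => h₁.1 j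
  have hv := Finset.sum_nonneg fun j (_ : j ∈ D) => h₂.1 j
  rcases hu.eq_or_lt with hu | hu
  · refine ⟨w₂, h₂, ?_⟩
    rw [← hu, Real.zero_rpow hs0.ne', zero_add]
    exact Real.rpow_le_rpow hv (Finset.sum_le_sum_of_subset_of_nonneg Finset.subset_union_right
      fun j _ _ => h₂.1 j) hs0.le
  rcases hv.eq_or_lt with hv | hv
  · refine ⟨w₁, h₁, ?_⟩
    rw [← hv, Real.zero_rpow hs0.ne', add_zero]
    exact Real.rpow_le_rpow hu.le (Finset.sum_le_sum_of_subset_of_nonneg Finset.subset_union_left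
      fun j _ _ => h₁.1 j) hs0.le
  obtain ⟨α, β, hα, hβ, heq, hle⟩ := exists_dual_weights hs hu hv
  set w : J → ℝ := fun j => α * (if j ∈ H then w₁ j else 0) + β * (if j ∈ D then w₂ j else 0)
  have hw : ∀ T, ∑ j ∈ T, w j = α * ∑ j ∈ T ∩ H, w₁ j + β * ∑ j ∈ T ∩ D, w₂ j := fun T => by
    simp only [w, Finset.sum_add_distrib, ← Finset.mul_sum, Finset.sum_ite_mem]
  have hw0 : ∀ j, 0 ≤ w j := fun j => by
    have := h₁.1 j
    have := h₂.1 j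
    simp only [w]; split_ifs <;> positivity
  refine ⟨w, ⟨hw0, fun T => ?_⟩, ?_⟩
  · refine (Real.rpow_le_rpow_iff (Finset.sum_nonneg fun j _ => hw0 j) (h0 T) hs0).1 ?_
    rw [hw]
    have hdis : Disjoint (T ∩ H) (T ∩ D) :=
      hHD.mono Finset.inter_subset_right Finset.inter_subset_right
    calc _ ≤ (∑ j ∈ T ∩ H, w₁ j) ^ s + (∑ j ∈ T ∩ D, w₂ j) ^ s :=
          hle _ _ (Finset.sum_nonneg fun j _ => h₁.1 j) (Finset.sum_nonneg fun j _ => h₂.1 j)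
      _ ≤ χ (T ∩ H) ^ s + χ (T ∩ D) ^ s := add_le_add
          (Real.rpow_le_rpow (Finset.sum_nonneg fun j _ => h₁.1 j) (h₁.2 _) hs0.le)
          (Real.rpow_le_rpow (Finset.sum_nonneg fun j _ => h₂.1 j) (h₂.2 _) hs0.le)
      _ ≤ χ (T ∩ H ∪ T ∩ D) ^ s := hsup _ _ hdis
      _ ≤ χ T ^ s := Real.rpow_le_rpow (h0 _)
          (finset_monotone_of_superadditive_rpow hs0 h0 hsup
            (Finset.union_subset Finset.inter_subset_left Finset.inter_subset_left)) hs0.le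
  · rw [hw, Finset.inter_eq_right.2 Finset.subset_union_left,
      Finset.inter_eq_right.2 Finset.subset_union_right, heq]

/-- A submeasure on a finite set with a lower `s`-estimate dominates a measure of comparable total
mass. -/
theorem exists_large_dominatedWeights {J : Type*} [Fintype J] [DecidableEq J]
    (χ : Finset J → ℝ) {s : ℝ} (hs : 1 ≤ s) (h0 : ∀ T, 0 ≤ χ T)
    (hsub : ∀ T U, Disjoint T U → χ (T ∪ U) ≤ χ T + χ U)
    (hsup : ∀ T U, Disjoint T U → χ T ^ s + χ U ^ s ≤ χ (T ∪ U) ^ s) :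
    ∃ w ∈ dominatedWeights χ, kConst s * χ Finset.univ ≤ ∑ j, w j := by
  have hs0 : 0 < s := by linarith
  have hmono : ∀ {T U : Finset J}, T ⊆ U → χ T ≤ χ U := fun h =>
    finset_monotone_of_superadditive_rpow hs0 h0 hsup h
  have hempty : χ ∅ = 0 := by
    have := hsup ∅ ∅ (Finset.disjoint_empty_left _)
    rw [Finset.union_empty] at this
    by_contra hne
    have := Real.rpow_pos_of_pos (lt_of_le_of_ne (h0 ∅) (Ne.symm hne)) s
    linarith
  choose W hW hWmax using exists_max_dominatedWeights χ h0
  set κ : Finset J → ℝ := fun E => ∑ j ∈ E, W E j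
  rcases (h0 Finset.univ).eq_or_lt with huniv | huniv
  · exact ⟨W Finset.univ, hW _, by
      rw [← huniv, mul_zero]; exact Finset.sum_nonneg fun j _ => (hW _).1 j⟩
  have hκsup : ∀ {w} (_ : w ∈ dominatedWeights χ) {H D : Finset J}, Disjoint H D →
      (∑ j ∈ H, w j) ^ s + κ D ^ s ≤ κ (H ∪ D) ^ s := by
    intro w hw H D hHD
    obtain ⟨v, hv, hv'⟩ := dominatedWeights_superadditive hs h0 hsup hHD hw (hW D)
    exact hv'.trans (Real.rpow_le_rpow (Finset.sum_nonneg fun j _ => hv.1 j) (hWmax _ v hv) hs0.le)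
  have hκ0 : ∀ E, 0 ≤ κ E := fun E => Finset.sum_nonneg fun j _ => (hW E).1 j
  -- κ(E) is the largest dominated mass on E. It suffices that the least ratio K = κ(E)/χ(E) is at
  -- least K_s, and the argument takes place inside a minimising E.
  obtain ⟨E, hE, hEmin⟩ := Finset.exists_min_image
    (Finset.univ.filter fun E : Finset J => 0 < χ E) (fun E => κ E / χ E)
    ⟨Finset.univ, by simpa using huniv⟩
  simp only [Finset.mem_filter, Finset.mem_univ, true_and] at hE hEmin
  set K := κ E / χ E with hK
  have hKχ : ∀ T, K * χ T ≤ κ T := by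
    intro T
    rcases (h0 T).eq_or_lt with h | h
    · rw [← h, mul_zero]; exact hκ0 T
    · exact (le_div_iff₀ h).1 (hEmin T h)
  have hκE : κ E = K * χ E := by rw [hK, div_mul_cancel₀ _ hE.ne']
  have hsumχ : ∀ T, χ T ≤ ∑ j ∈ T, χ {j} := by
    intro T
    induction T using Finset.induction_on with
    | empty => simp [hempty]
    | insert a T ha ih =>
      rw [Finset.sum_insert ha, Finset.insert_eq]
      exact (hsub _ _ (Finset.disjoint_singleton_left.2 ha)).trans (by linarith)
  have hκEpos : 0 < κ E := by
    obtain ⟨j, hj, hjpos⟩ : ∃ j ∈ E, 0 < χ {j} := by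
      by_contra! hcon
      exact absurd (hsumχ E) (not_le.2 ((Finset.sum_nonpos hcon).trans_lt hE))
    have : (fun i => if i = j then χ {j} else 0) ∈ dominatedWeights χ := by
      refine ⟨fun i => ?_, fun T => ?_⟩
      · dsimp only
        split_ifs
        exacts [h0 _, le_rfl]
      · rw [Finset.sum_ite_eq']
        split_ifs with h
        · exact hmono (by simpa using h)
        · exact h0 T
    have h2 := hWmax E _ this
    rw [Finset.sum_ite_eq', if_pos hj] at h2
    exact hjpos.trans_le h2
  have hKpos : 0 < K := div_pos hκEpos hE
  suffices hmain : kConst s ≤ K from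
    ⟨W Finset.univ, hW _, (mul_le_mul_of_nonneg_right hmain huniv.le).trans (hKχ _)⟩
  by_contra! hlt
  set y := halfDual s with hy
  have hypos : 0 < y := halfDual_pos hs0
  have hys : y ^ s = 1 - (1 / 2 : ℝ) ^ s := halfDual_rpow hs0
  have hyK : y < 1 / (1 + K) := by
    rw [kConst_eq hs0] at hlt
    rw [lt_div_iff₀ (by linarith), mul_comm, ← lt_div_iff₀ hypos]
    linarith
  -- The slack y < z < 1/(1 + K) provides the strict inequalities that follow; p is the optimal
  -- measure on E, normalised to mass 1.
  obtain ⟨z, hyz, hzK⟩ := exists_between hyK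
  have hzpos : 0 < z := hypos.trans hyz
  set p : Finset J → ℝ := fun T => (∑ j ∈ T, W E j) / κ E with hp
  have hp0 : ∀ T, 0 ≤ p T := fun T =>
    div_nonneg (Finset.sum_nonneg fun j _ => (hW E).1 j) hκEpos.le
  have hpE : p E = 1 := div_self hκEpos.ne'
  have hpadd : ∀ T U, Disjoint T U → p (T ∪ U) = p T + p U := fun T U h => by
    simp only [hp, Finset.sum_union h, add_div]
  have hone : ∀ H ⊆ E, p H ^ s + (κ (E \ H) / κ E) ^ s ≤ 1 := by
    intro H hH
    have h := hκsup (hW E) (Finset.disjoint_sdiff (s := H) (t := E))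
    rw [Finset.union_sdiff_of_subset hH] at h
    simp only [hp]
    rw [Real.div_rpow (Finset.sum_nonneg fun j _ => (hW E).1 j) hκEpos.le,
      Real.div_rpow (hκ0 _) hκEpos.le, ← add_div]
    exact (div_le_one (Real.rpow_pos_of_pos hκEpos s)).2 h
  have hκD : ∀ H ⊆ E, p H ≤ 1 / 2 → κ (E \ H) ≤ 2 * y * (1 - p H) * κ E := by
    intro H hH hpH
    by_contra! hcon
    rw [← lt_div_iff₀ hκEpos] at hcon
    have hd : 0 < 1 - p H := by linarith
    have h1 := hone H hH
    have h2 : (2 * y * (1 - p H)) ^ s < (κ (E \ H) / κ E) ^ s :=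
      Real.rpow_lt_rpow (by positivity) hcon hs0
    -- This coefficient sends (2y(1 - p H), p H) to (y, 1/2), where y^s + (1/2)^s = 1.
    have hl : 0 < 1 / (2 * (1 - p H)) := by positivity
    have h3 := convex_comb_rpow_le (p := 2 * y * (1 - p H)) (q := p H) hs hl.le
      ((div_le_one (by positivity)).2 (by linarith)) (by positivity) (hp0 H)
    have e1 : 1 / (2 * (1 - p H)) * (2 * y * (1 - p H)) = y := by field_simp
    have e2 : (1 - 1 / (2 * (1 - p H))) + 1 / (2 * (1 - p H)) * p H = 1 / 2 := by
      field_simp; ring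
    rw [e1, e2, hys] at h3
    nlinarith
  set F : Finset (Finset J) := E.powerset.filter fun H => χ H ≤ 2 * z * κ E * p H
  -- A maximal H on which χ is small relative to p must have p(H) > 1/2. Otherwise 2z W_E on E \ H
  -- has mass exceeding κ(E \ H), so it is not dominated, and a violating set can be added to H.
  obtain ⟨H, hHF, hHmax⟩ := F.exists_maximal ⟨∅, by simp [F, hempty, hp]⟩
  simp only [F, Finset.mem_filter, Finset.mem_powerset] at hHF hHmax
  obtain ⟨hHE, hHχ⟩ := hHF
  have hpH : 1 / 2 < p H := by
    by_contra! hpH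
    set D := E \ H
    have hpD : p D = 1 - p H := by
      have := hpadd H D Finset.disjoint_sdiff
      rw [Finset.union_sdiff_of_subset hHE, hpE] at this
      linarith
    have hnot : (fun j => if j ∈ D then 2 * z * W E j else 0) ∉ dominatedWeights χ := by
      intro hmem
      have h1 := hWmax D _ hmem
      rw [Finset.sum_ite_mem, Finset.inter_self, ← Finset.mul_sum] at h1
      have h2 := hκD H hHE hpH
      have h3 : ∑ j ∈ D, W E j = p D * κ E := by rw [hp]; field_simp
      have h4 : ∑ j ∈ D, W D j = κ D := rfl
      rw [h3, h4, hpD] at h1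
      have h5 : 0 < (1 - p H) * κ E := mul_pos (by linarith) hκEpos
      nlinarith
    obtain ⟨T, hT⟩ : ∃ T, χ T < ∑ j ∈ T, if j ∈ D then 2 * z * W E j else 0 := by
      by_contra! hcon
      refine hnot ⟨fun j => ?_, hcon⟩
      have := (hW E).1 j
      dsimp only
      split_ifs <;> positivity
    rw [Finset.sum_ite_mem, ← Finset.mul_sum] at hT
    have hsubD : T ∩ D ⊆ D := Finset.inter_subset_right
    have hdis : Disjoint H (T ∩ D) := Finset.disjoint_sdiff.mono_right hsubD
    have hA : χ (T ∩ D) ≤ 2 * z * κ E * p (T ∩ D) := by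
      have : 2 * z * κ E * p (T ∩ D) = 2 * z * ∑ j ∈ T ∩ D, W E j := by
        simp only [hp]; field_simp
      rw [this]
      exact (hmono Finset.inter_subset_left).trans hT.le
    have hle := hHmax (y := H ∪ T ∩ D)
      ⟨Finset.union_subset hHE (hsubD.trans Finset.sdiff_subset), by
        rw [hpadd _ _ hdis, mul_add]
        exact (hsub _ _ hdis).trans (add_le_add hHχ hA)⟩ Finset.subset_union_left
    have : T ∩ D = ∅ := Finset.disjoint_self_iff_empty _ |>.1
      (hdis.mono_left (Finset.subset_union_right.trans hle))
    rw [this, Finset.sum_empty, mul_zero] at hT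
    exact absurd (h0 T) (not_le.2 hT)
  have hp' : 0 < p H := by linarith
  have hpH1 : p H ≤ 1 := by
    rw [← hpE, ← Finset.union_sdiff_of_subset hHE, hpadd _ _ Finset.disjoint_sdiff]
    linarith [hp0 (E \ H)]
  -- Subadditivity makes χ large on E \ H, and minimality of K passes this to κ. Sliding p(H) down
  -- to 1/2 then moves the other coordinate to at least 1 - zK > z > y, against y^s + (1/2)^s = 1.
  have hq : 1 - 2 * z * K * p H ≤ χ (E \ H) / χ E := by
    have h1 := hsub H (E \ H) Finset.disjoint_sdiff
    rw [Finset.union_sdiff_of_subset hHE] at h1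
    rw [le_div_iff₀ hE]
    rw [hκE] at hHχ
    nlinarith
  have hq2 : χ (E \ H) / χ E ≤ κ (E \ H) / κ E := by
    rw [div_le_div_iff₀ hE hκEpos, hκE]
    have := hKχ (E \ H)
    nlinarith
  set q := χ (E \ H) / χ E
  have hq0 : 0 ≤ q := div_nonneg (h0 _) hE.le
  have h1 : p H ^ s + q ^ s ≤ 1 :=
    (add_le_add_right (Real.rpow_le_rpow hq0 hq2 hs0.le) _).trans (hone H hHE)
  have hl : 0 < 1 / (2 * p H) := by positivity
  have hl1 : 1 / (2 * p H) ≤ 1 := (div_le_one (by positivity)).2 (by linarith)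
  have h2 := convex_comb_rpow_le (p := p H) (q := q) hs hl.le hl1 hp'.le hq0
  have e1 : 1 / (2 * p H) * p H = 1 / 2 := by field_simp
  have e2 : z < (1 - 1 / (2 * p H)) + 1 / (2 * p H) * q := by
    have h3 := mul_le_mul_of_nonneg_left hq hl.le
    have e3 : 1 / (2 * p H) * (1 - 2 * z * K * p H) = 1 / (2 * p H) - z * K := by field_simp
    rw [lt_div_iff₀ (by linarith)] at hzK
    linarith
  have h3 : y ^ s < ((1 - 1 / (2 * p H)) + 1 / (2 * p H) * q) ^ s :=
    Real.rpow_lt_rpow hypos.le (hyz.trans e2) hs0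
  rw [e1] at h2
  nlinarith

end FiniteSubmeasure

/-! ### Supermeasures on a finite set: small dominating measures. -/

section FiniteSupermeasure

/-- The weights on a finite set whose total over every subset of `E` dominates `θ`. -/
def dominatingWeights {J : Type*} (θ : Finset J → ℝ) (E : Finset J) : Set (J → ℝ) :=
  {w | (∀ j, 0 ≤ w j) ∧ ∀ T ⊆ E, θ T ≤ ∑ j ∈ T, w j}

/-- Dominating weights are unbounded, but truncating them at B = θ(J) preserves domination: one
coordinate equal to B already dominates θ on every set containing it. So the minimum may be sought
in a compact box. -/
lemma exists_min_dominatingWeights {J : Type*} [Fintype J] (θ : Finset J → ℝ)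
    (h0 : ∀ T, 0 ≤ θ T) (hempty : θ ∅ = 0) (hmono : ∀ T U, T ⊆ U → θ T ≤ θ U) (E : Finset J) :
    ∃ w ∈ dominatingWeights θ E, ∀ v ∈ dominatingWeights θ E, ∑ j ∈ E, w j ≤ ∑ j ∈ E, v j := by
  set B := θ Finset.univ
  set S := dominatingWeights θ E ∩ Icc 0 fun _ => B
  have htrunc : ∀ v ∈ dominatingWeights θ E, (fun j => min (v j) B) ∈ S := by
    intro v hv
    have hnn : ∀ j, 0 ≤ min (v j) B := fun j => le_min (hv.1 j) (h0 _)
    refine ⟨⟨hnn, fun T hT => ?_⟩, hnn, fun j => min_le_right _ _⟩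
    by_cases h : ∃ j ∈ T, B < v j
    · obtain ⟨j, hj, hjB⟩ := h
      calc θ T ≤ B := hmono _ _ (Finset.subset_univ _)
        _ = min (v j) B := (min_eq_right hjB.le).symm
        _ ≤ _ := Finset.single_le_sum (f := fun j => min (v j) B) (fun i _ => hnn i) hj
    · push Not at h
      rw [Finset.sum_congr rfl fun j hj => min_eq_left (h j hj)]
      exact hv.2 T hT
  have hc : IsCompact S := by
    refine (isCompact_Icc (a := (0 : J → ℝ)) (b := fun _ => B)).inter_left ?_
    have : dominatingWeights θ E
        = (⋂ j, {w : J → ℝ | 0 ≤ w j}) ∩ ⋂ T, ⋂ (_ : T ⊆ E), {w : J → ℝ | θ T ≤ ∑ j ∈ T, w j} := by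
      ext w; simp [dominatingWeights]
    rw [this]
    exact (isClosed_iInter fun j => isClosed_le continuous_const (continuous_apply j)).inter
      (isClosed_iInter fun T => isClosed_iInter fun _ =>
        isClosed_le continuous_const (by fun_prop))
  have hne : S.Nonempty := by
    refine ⟨_, htrunc (fun _ => B) ⟨fun _ => h0 _, fun T _ => ?_⟩⟩
    rcases T.eq_empty_or_nonempty with rfl | hT
    · simp [hempty]
    · obtain ⟨j, hj⟩ := hT
      exact (hmono _ _ (Finset.subset_univ _)).trans
        (Finset.single_le_sum (f := fun _ => B) (fun i _ => h0 _) hj)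
  obtain ⟨w, hw, hmin⟩ := hc.exists_isMinOn hne
    (f := fun w : J → ℝ => ∑ j ∈ E, w j) (by fun_prop)
  exact ⟨w, hw.1, fun v hv => (hmin (htrunc v hv)).trans
    (Finset.sum_le_sum fun j _ => min_le_left _ _)⟩

/-- Gluing with extremal weights again, now by the reverse Hölder inequality. Domination is tested
only on T ⊆ H ∪ D, so T is the union of T ∩ H and T ∩ D and subadditivity of θ^r applies. -/
lemma dominatingWeights_subadditive {J : Type*} [DecidableEq J] {θ : Finset J → ℝ} {r : ℝ}
    (hr0 : 0 < r) (hr : r ≤ 1) (h0 : ∀ T, 0 ≤ θ T)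
    (hsub : ∀ T U, Disjoint T U → θ (T ∪ U) ^ r ≤ θ T ^ r + θ U ^ r)
    {H D : Finset J} (hHD : Disjoint H D) {w₁ w₂ : J → ℝ} (h₁ : w₁ ∈ dominatingWeights θ H)
    (h₂ : w₂ ∈ dominatingWeights θ D) :
    ∃ w ∈ dominatingWeights θ (H ∪ D),
      (∑ j ∈ H ∪ D, w j) ^ r ≤ (∑ j ∈ H, w₁ j) ^ r + (∑ j ∈ D, w₂ j) ^ r := by
  have hu := Finset.sum_nonneg fun j (_ : j ∈ H) => h₁.1 j
  have hv := Finset.sum_nonneg fun j (_ : j ∈ D) => h₂.1 j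
  obtain ⟨α, β, hα, hβ, heq, hle⟩ := exists_reverse_dual_weights hr0 hr hu hv
  set w : J → ℝ := fun j => α * (if j ∈ H then w₁ j else 0) + β * (if j ∈ D then w₂ j else 0)
  have hw : ∀ T, ∑ j ∈ T, w j = α * ∑ j ∈ T ∩ H, w₁ j + β * ∑ j ∈ T ∩ D, w₂ j := fun T => by
    simp only [w, Finset.sum_add_distrib, ← Finset.mul_sum, Finset.sum_ite_mem]
  have hw0 : ∀ j, 0 ≤ w j := fun j => by
    have := h₁.1 j
    have := h₂.1 j
    simp only [w]; split_ifs <;> positivity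
  refine ⟨w, ⟨hw0, fun T hT => ?_⟩, ?_⟩
  · refine (Real.rpow_le_rpow_iff (h0 T) (Finset.sum_nonneg fun j _ => hw0 j) hr0).1 ?_
    rw [hw]
    have hdis : Disjoint (T ∩ H) (T ∩ D) :=
      hHD.mono Finset.inter_subset_right Finset.inter_subset_right
    have hTu : T ∩ H ∪ T ∩ D = T := by
      rw [← Finset.inter_union_distrib_left, Finset.inter_eq_left.2 hT]
    calc θ T ^ r = θ (T ∩ H ∪ T ∩ D) ^ r := by rw [hTu]
      _ ≤ θ (T ∩ H) ^ r + θ (T ∩ D) ^ r := hsub _ _ hdis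
      _ ≤ (∑ j ∈ T ∩ H, w₁ j) ^ r + (∑ j ∈ T ∩ D, w₂ j) ^ r := add_le_add
          (Real.rpow_le_rpow (h0 _) (h₁.2 _ Finset.inter_subset_right) hr0.le)
          (Real.rpow_le_rpow (h0 _) (h₂.2 _ Finset.inter_subset_right) hr0.le)
      _ ≤ _ := hle _ _ (Finset.sum_nonneg fun j _ => h₁.1 j)
          (Finset.sum_le_sum_of_subset_of_nonneg Finset.inter_subset_right fun j _ _ => h₁.1 j)
          (Finset.sum_nonneg fun j _ => h₂.1 j)
          (Finset.sum_le_sum_of_subset_of_nonneg Finset.inter_subset_right fun j _ _ => h₂.1 j)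
  · rw [hw, Finset.inter_eq_right.2 Finset.subset_union_left,
      Finset.inter_eq_right.2 Finset.subset_union_right, heq]

/-- A supermeasure on a finite set with an upper `r`-estimate is dominated by a measure of
comparable total mass. -/
theorem exists_small_dominatingWeights {J : Type*} [Fintype J] [DecidableEq J]
    (θ : Finset J → ℝ) {r : ℝ} (hr0 : 0 < r) (hr : r ≤ 1) (h0 : ∀ T, 0 ≤ θ T)
    (hsup : ∀ T U, Disjoint T U → θ T + θ U ≤ θ (T ∪ U))
    (hsub : ∀ T U, Disjoint T U → θ (T ∪ U) ^ r ≤ θ T ^ r + θ U ^ r) :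
    ∃ w ∈ dominatingWeights θ Finset.univ, ∑ j, w j ≤ kConst r * θ Finset.univ := by
  have hmono : ∀ T U : Finset J, T ⊆ U → θ T ≤ θ U := fun T U h => by
    have h1 := hsup T (U \ T) Finset.disjoint_sdiff
    rw [Finset.union_sdiff_of_subset h] at h1
    linarith [h0 (U \ T)]
  have hempty : θ ∅ = 0 := by
    have := hsup ∅ ∅ (Finset.disjoint_empty_left _)
    rw [Finset.union_empty] at this
    linarith [h0 ∅]
  choose W hW hWmin using exists_min_dominatingWeights θ h0 hempty hmono
  set κ : Finset J → ℝ := fun E => ∑ j ∈ E, W E j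
  have hκ0 : ∀ E, 0 ≤ κ E := fun E => Finset.sum_nonneg fun j _ => (hW E).1 j
  have hκzero : ∀ T, θ T = 0 → κ T = 0 := fun T hT => by
    refine le_antisymm ?_ (hκ0 T)
    have := hWmin T (fun _ => 0) ⟨fun _ => le_rfl, fun U hU => by
      simpa [hT] using hmono U T hU⟩
    simpa using this
  rcases (h0 Finset.univ).eq_or_lt with huniv | huniv
  · exact ⟨W Finset.univ, hW _, by
      rw [← huniv, mul_zero]; exact (hκzero _ huniv.symm).le⟩
  have hκsub : ∀ {H D : Finset J} {w} (_ : w ∈ dominatingWeights θ H), Disjoint H D →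
      κ (H ∪ D) ^ r ≤ (∑ j ∈ H, w j) ^ r + κ D ^ r := by
    intro H D w hw hHD
    obtain ⟨v, hv, hv'⟩ := dominatingWeights_subadditive hr0 hr h0 hsub hHD hw (hW D)
    exact (Real.rpow_le_rpow (hκ0 _) (hWmin _ v hv) hr0.le).trans hv'
  -- The mirror image of the submeasure argument: κ is now a minimal mass, K a maximal ratio, 1/(1 +
  -- K) < z < y, and concavity of t^r replaces convexity.
  obtain ⟨E, hE, hEmax⟩ := Finset.exists_max_image
    (Finset.univ.filter fun E : Finset J => 0 < θ E) (fun E => κ E / θ E)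
    ⟨Finset.univ, by simpa using huniv⟩
  simp only [Finset.mem_filter, Finset.mem_univ, true_and] at hE hEmax
  set K := κ E / θ E with hK
  have hKθ : ∀ T, κ T ≤ K * θ T := by
    intro T
    rcases (h0 T).eq_or_lt with h | h
    · rw [hκzero T h.symm, ← h, mul_zero]
    · exact (div_le_iff₀ h).1 (hEmax T h)
  have hκE : κ E = K * θ E := by rw [hK, div_mul_cancel₀ _ hE.ne']
  have hκEpos : 0 < κ E := hE.trans_le ((hW E).2 E subset_rfl)
  have hKpos : 0 < K := div_pos hκEpos hE
  suffices hmain : K ≤ kConst r from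
    ⟨W Finset.univ, hW _, (hKθ _).trans (mul_le_mul_of_nonneg_right hmain huniv.le)⟩
  by_contra! hlt
  set y := halfDual r with hy
  have hypos : 0 < y := halfDual_pos hr0
  have hyr : y ^ r = 1 - (1 / 2 : ℝ) ^ r := halfDual_rpow hr0
  have hyK : 1 / (1 + K) < y := by
    rw [kConst_eq hr0] at hlt
    rw [div_lt_iff₀ (by linarith), mul_comm, ← div_lt_iff₀ hypos]
    linarith
  obtain ⟨z, hzK, hzy⟩ := exists_between hyK
  have hzpos : 0 < z := (by positivity : 0 < 1 / (1 + K)).trans hzK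
  set p : Finset J → ℝ := fun T => (∑ j ∈ T, W E j) / κ E with hp
  have hp0 : ∀ T, 0 ≤ p T := fun T =>
    div_nonneg (Finset.sum_nonneg fun j _ => (hW E).1 j) hκEpos.le
  have hpE : p E = 1 := div_self hκEpos.ne'
  have hpadd : ∀ T U, Disjoint T U → p (T ∪ U) = p T + p U := fun T U h => by
    simp only [hp, Finset.sum_union h, add_div]
  have hone : ∀ H ⊆ E, 1 ≤ p H ^ r + (κ (E \ H) / κ E) ^ r := by
    intro H hH
    have h := hκsub (H := H) (w := W E) ⟨(hW E).1, fun T hT => (hW E).2 T (hT.trans hH)⟩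
      (Finset.disjoint_sdiff (s := H) (t := E))
    rw [Finset.union_sdiff_of_subset hH] at h
    simp only [hp]
    rw [Real.div_rpow (Finset.sum_nonneg fun j _ => (hW E).1 j) hκEpos.le,
      Real.div_rpow (hκ0 _) hκEpos.le, ← add_div]
    exact (one_le_div (Real.rpow_pos_of_pos hκEpos r)).2 h
  have hκD : ∀ H ⊆ E, p H ≤ 1 / 2 → 2 * y * (1 - p H) * κ E ≤ κ (E \ H) := by
    intro H hH hpH
    by_contra! hcon
    rw [← div_lt_iff₀ hκEpos] at hcon
    have hd : 0 < 1 - p H := by linarith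
    have h1 := hone H hH
    have h2 : (κ (E \ H) / κ E) ^ r < (2 * y * (1 - p H)) ^ r :=
      Real.rpow_lt_rpow (div_nonneg (hκ0 _) hκEpos.le) hcon hr0
    have hl : 0 < 1 / (2 * (1 - p H)) := by positivity
    have h3 := le_concave_comb_rpow (p := 2 * y * (1 - p H)) (q := p H) hr0 hr hl.le
      ((div_le_one (by positivity)).2 (by linarith)) (by positivity) (hp0 H)
    have e1 : 1 / (2 * (1 - p H)) * (2 * y * (1 - p H)) = y := by field_simp
    have e2 : (1 - 1 / (2 * (1 - p H))) + 1 / (2 * (1 - p H)) * p H = 1 / 2 := by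
      field_simp; ring
    rw [e1, e2, hyr] at h3
    nlinarith
  set F : Finset (Finset J) := E.powerset.filter fun H => 2 * z * κ E * p H ≤ θ H
  obtain ⟨H, hHF, hHmax⟩ := F.exists_maximal ⟨∅, by simp [F, hempty, hp]⟩
  simp only [F, Finset.mem_filter, Finset.mem_powerset] at hHF hHmax
  obtain ⟨hHE, hHθ⟩ := hHF
  have hpH : 1 / 2 < p H := by
    by_contra! hpH
    set D := E \ H
    have hpD : p D = 1 - p H := by
      have := hpadd H D Finset.disjoint_sdiff
      rw [Finset.union_sdiff_of_subset hHE, hpE] at this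
      linarith
    have hnot : (fun j => 2 * z * W E j) ∉ dominatingWeights θ D := by
      intro hmem
      have h1 := hWmin D _ hmem
      rw [← Finset.mul_sum] at h1
      have h2 := hκD H hHE hpH
      have h3 : ∑ j ∈ D, W E j = p D * κ E := by rw [hp]; field_simp
      have h4 : ∑ j ∈ D, W D j = κ D := rfl
      rw [h3, h4, hpD] at h1
      have h5 : 0 < (1 - p H) * κ E := mul_pos (by linarith) hκEpos
      nlinarith
    obtain ⟨T, hTD, hT⟩ : ∃ T ⊆ D, ∑ j ∈ T, 2 * z * W E j < θ T := by
      by_contra! hcon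
      refine hnot ⟨fun j => ?_, hcon⟩
      have := (hW E).1 j
      positivity
    rw [← Finset.mul_sum] at hT
    have hdis : Disjoint H T := Finset.disjoint_sdiff.mono_right hTD
    have hA : 2 * z * κ E * p T ≤ θ T := by
      have : 2 * z * κ E * p T = 2 * z * ∑ j ∈ T, W E j := by
        simp only [hp]; field_simp
      rw [this]
      exact hT.le
    have hle := hHmax (y := H ∪ T)
      ⟨Finset.union_subset hHE (hTD.trans Finset.sdiff_subset), by
        rw [hpadd _ _ hdis, mul_add]
        exact (add_le_add hHθ hA).trans (hsup _ _ hdis)⟩ Finset.subset_union_left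
    have : T = ∅ := Finset.disjoint_self_iff_empty _ |>.1
      (hdis.mono_left (Finset.subset_union_right.trans hle))
    rw [this, Finset.sum_empty, mul_zero, hempty] at hT
    exact lt_irrefl _ hT
  have hp' : 0 < p H := by linarith
  have hq : θ (E \ H) / θ E ≤ 1 - 2 * z * K * p H := by
    have h1 := hsup H (E \ H) Finset.disjoint_sdiff
    rw [Finset.union_sdiff_of_subset hHE] at h1
    rw [div_le_iff₀ hE]
    rw [hκE] at hHθ
    nlinarith
  have hq2 : κ (E \ H) / κ E ≤ θ (E \ H) / θ E := by
    rw [div_le_div_iff₀ hκEpos hE, hκE]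
    have := hKθ (E \ H)
    nlinarith
  set q := θ (E \ H) / θ E
  have hq0 : 0 ≤ q := div_nonneg (h0 _) hE.le
  have h1 : 1 ≤ p H ^ r + q ^ r := (hone H hHE).trans
    (add_le_add_right (Real.rpow_le_rpow (div_nonneg (hκ0 _) hκEpos.le) hq2 hr0.le) _)
  have hl : 0 < 1 / (2 * p H) := by positivity
  have hl1 : 1 / (2 * p H) ≤ 1 := (div_le_one (by positivity)).2 (by linarith)
  have h2 := le_concave_comb_rpow (p := p H) (q := q) hr0 hr hl.le hl1 hp'.le hq0
  have e1 : 1 / (2 * p H) * p H = 1 / 2 := by field_simp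
  have e2 : (1 - 1 / (2 * p H)) + 1 / (2 * p H) * q < z := by
    have h3 := mul_le_mul_of_nonneg_left hq hl.le
    have e3 : 1 / (2 * p H) * (1 - 2 * z * K * p H) = 1 / (2 * p H) - z * K := by field_simp
    rw [div_lt_iff₀ (by linarith)] at hzK
    linarith
  have h3 : ((1 - 1 / (2 * p H)) + 1 / (2 * p H) * q) ^ r < y ^ r :=
    Real.rpow_lt_rpow (add_nonneg (by linarith) (by positivity)) (e2.trans hzy) hr0
  rw [e1] at h2
  nlinarith

end FiniteSupermeasure

/-! ### Partition hulls and exact estimates. -/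

section Hulls

/-- A finite or infinite family of pairwise disjoint measurable sets with union `B`. -/
structure IsPartitionOf {Ω ι : Type*} [MeasurableSpace Ω] (A : ι → Set Ω) (B : Set Ω) : Prop where
  measurableSet : ∀ i, MeasurableSet (A i)
  pairwise_disjoint : Pairwise fun i j => Disjoint (A i) (A j)
  iUnion_eq : ⋃ i, A i = B

namespace IsPartitionOf

variable {Ω ι κ : Type*} [MeasurableSpace Ω] {A : ι → Set Ω} {A' : κ → Set Ω} {B B' : Set Ω}

lemma inter (h : IsPartitionOf A B) {D : Set Ω} (hD : MeasurableSet D) (hDB : D ⊆ B) :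
    IsPartitionOf (fun i => A i ∩ D) D where
  measurableSet i := (h.measurableSet i).inter hD
  pairwise_disjoint _ _ hij :=
    (h.pairwise_disjoint hij).mono inter_subset_left inter_subset_left
  iUnion_eq := by rw [← iUnion_inter, h.iUnion_eq, inter_eq_right.2 hDB]

lemma subset (h : IsPartitionOf A B) (i : ι) : A i ⊆ B := h.iUnion_eq ▸ subset_iUnion A i

lemma sumElim (h : IsPartitionOf A B) (h' : IsPartitionOf A' B') (hBB' : Disjoint B B') :
    IsPartitionOf (Sum.elim A A') (B ∪ B') where
  measurableSet := by rintro (i | i); exacts [h.measurableSet i, h'.measurableSet i]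
  pairwise_disjoint := by
    rintro (i | i) (j | j) hij
    · exact h.pairwise_disjoint fun e => hij (e ▸ rfl)
    · exact hBB'.mono (h.subset i) (h'.subset j)
    · exact (hBB'.mono (h.subset j) (h'.subset i)).symm
    · exact h'.pairwise_disjoint fun e => hij (e ▸ rfl)
  iUnion_eq := by
    rw [iUnion_sum]; simp [h.iUnion_eq, h'.iUnion_eq]

lemma comp_equiv (h : IsPartitionOf A B) (e : κ ≃ ι) : IsPartitionOf (A ∘ e) B where
  measurableSet i := h.measurableSet (e i)
  pairwise_disjoint _ _ hij := h.pairwise_disjoint (e.injective.ne hij)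
  iUnion_eq := by rw [← h.iUnion_eq]; exact e.surjective.iUnion_comp A

lemma unit (hB : MeasurableSet B) : IsPartitionOf (fun _ : Unit => B) B where
  measurableSet _ := hB
  pairwise_disjoint i j hij := absurd (Subsingleton.elim i j) hij
  iUnion_eq := iUnion_const B

lemma bool (hB : MeasurableSet B) (hB' : MeasurableSet B') (hd : Disjoint B B') :
    IsPartitionOf (fun b : Bool => cond b B B') (B ∪ B') where
  measurableSet := by rintro (_ | _); exacts [hB', hB]
  pairwise_disjoint := by
    rintro (_ | _) (_ | _) hij
    exacts [absurd rfl hij, hd.symm, hd, absurd rfl hij]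
  iUnion_eq := (union_eq_iUnion).symm

end IsPartitionOf

variable {Ω : Type*} [MeasurableSpace Ω]

/-- The supremum of the sums of `F` over the finite measurable partitions of `B`. -/
noncomputable def supHull (F : Set Ω → ℝ≥0∞) (B : Set Ω) : ℝ≥0∞ :=
  ⨆ (n : ℕ) (A : Fin n → Set Ω) (_ : IsPartitionOf A B), ∑ i, F (A i)

/-- The infimum of the sums of `F` over the finite measurable partitions of `B`. -/
noncomputable def infHull (F : Set Ω → ℝ≥0∞) (B : Set Ω) : ℝ≥0∞ :=
  ⨅ (n : ℕ) (A : Fin n → Set Ω) (_ : IsPartitionOf A B), ∑ i, F (A i)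

lemma sum_le_supHull (F : Set Ω → ℝ≥0∞) {ι : Type*} [Fintype ι] {A : ι → Set Ω} {B : Set Ω}
    (h : IsPartitionOf A B) : ∑ i, F (A i) ≤ supHull F B := by
  have e := (Fintype.equivFin ι).symm
  rw [← e.sum_comp]
  exact le_iSup₂_of_le _ _ (le_iSup_of_le (h.comp_equiv e) le_rfl)

lemma infHull_le_sum (F : Set Ω → ℝ≥0∞) {ι : Type*} [Fintype ι] {A : ι → Set Ω} {B : Set Ω}
    (h : IsPartitionOf A B) : infHull F B ≤ ∑ i, F (A i) := by
  have e := (Fintype.equivFin ι).symm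
  rw [← e.sum_comp]
  exact iInf₂_le_of_le _ _ (iInf_le_of_le (h.comp_equiv e) le_rfl)

lemma supHull_le {F : Set Ω → ℝ≥0∞} {B : Set Ω} {c : ℝ≥0∞}
    (h : ∀ (n : ℕ) (A : Fin n → Set Ω), IsPartitionOf A B → ∑ i, F (A i) ≤ c) :
    supHull F B ≤ c :=
  iSup₂_le fun n A => iSup_le (h n A)

lemma le_infHull {F : Set Ω → ℝ≥0∞} {B : Set Ω} {c : ℝ≥0∞}
    (h : ∀ (n : ℕ) (A : Fin n → Set Ω), IsPartitionOf A B → c ≤ ∑ i, F (A i)) :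
    c ≤ infHull F B :=
  le_iInf₂ fun n A => le_iInf (h n A)

lemma le_mul_infHull {F : Set Ω → ℝ≥0∞} {B : Set Ω} {c d : ℝ≥0∞} (hd0 : d ≠ 0) (hd : d ≠ ∞)
    (h : ∀ (n : ℕ) (A : Fin n → Set Ω), IsPartitionOf A B → c ≤ d * ∑ i, F (A i)) :
    c ≤ d * infHull F B := by
  rw [mul_comm, ← ENNReal.div_le_iff hd0 hd]
  refine le_infHull fun n A hA => ?_
  rw [ENNReal.div_le_iff hd0 hd, mul_comm]
  exact h n A hA

lemma le_supHull_self (F : Set Ω → ℝ≥0∞) {B : Set Ω} (hB : MeasurableSet B) :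
    F B ≤ supHull F B := by
  simpa using sum_le_supHull F (IsPartitionOf.unit hB)

lemma infHull_le_self (F : Set Ω → ℝ≥0∞) {B : Set Ω} (hB : MeasurableSet B) :
    infHull F B ≤ F B := by
  simpa using infHull_le_sum F (IsPartitionOf.unit hB)

lemma supHull_add_le (F : Set Ω → ℝ≥0∞) {B B' : Set Ω} (hd : Disjoint B B')
    (hB : MeasurableSet B) (hB' : MeasurableSet B') :
    supHull F B + supHull F B' ≤ supHull F (B ∪ B') := by
  have key : ∀ (n : ℕ) (A : Fin n → Set Ω), IsPartitionOf A B → ∀ (m : ℕ) (A' : Fin m → Set Ω),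
      IsPartitionOf A' B' → ∑ i, F (A i) + ∑ i, F (A' i) ≤ supHull F (B ∪ B') := by
    intro n A hA m A' hA'
    simpa using sum_le_supHull F (hA.sumElim hA' hd)
  -- The two suprema are separated by subtraction in `ℝ≥0∞`, which needs finite terms.
  rcases eq_or_ne (supHull F (B ∪ B')) ∞ with htop | htop
  · rw [htop]; exact le_top
  have h1 : ∀ (m : ℕ) (A' : Fin m → Set Ω), IsPartitionOf A' B' →
      supHull F B + ∑ i, F (A' i) ≤ supHull F (B ∪ B') := by
    intro m A' hA'
    have hfin : ∑ i, F (A' i) ≠ ∞ := ne_top_of_le_ne_top htop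
      (le_add_self.trans (key _ _ ((IsPartitionOf.unit hB).comp_equiv
        (Fintype.equivFin Unit).symm) m A' hA'))
    refine (ENNReal.le_sub_iff_add_le_right hfin
      (le_add_self.trans (key _ _ ((IsPartitionOf.unit hB).comp_equiv
        (Fintype.equivFin Unit).symm) m A' hA'))).1 (supHull_le fun n A hA => ?_)
    exact ENNReal.le_sub_of_add_le_right hfin (key n A hA m A' hA')
  have hle : supHull F B ≤ supHull F (B ∪ B') := le_self_add.trans (h1 _ _
    ((IsPartitionOf.unit hB').comp_equiv (Fintype.equivFin Unit).symm))
  have hfin : supHull F B ≠ ∞ := ne_top_of_le_ne_top htop hle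
  refine (ENNReal.le_sub_iff_add_le_left hfin hle).1 (supHull_le fun m A' hA' => ?_)
  exact ENNReal.le_sub_of_add_le_left hfin (h1 m A' hA')

lemma infHull_union_le (F : Set Ω → ℝ≥0∞) {B B' : Set Ω} (hd : Disjoint B B') :
    infHull F (B ∪ B') ≤ infHull F B + infHull F B' := by
  have key : ∀ (n : ℕ) (A : Fin n → Set Ω), IsPartitionOf A B → ∀ (m : ℕ) (A' : Fin m → Set Ω),
      IsPartitionOf A' B' → infHull F (B ∪ B') ≤ ∑ i, F (A i) + ∑ i, F (A' i) := by
    intro n A hA m A' hA'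
    simpa using infHull_le_sum F (hA.sumElim hA' hd)
  rw [← tsub_le_iff_left]
  refine le_infHull fun m A' hA' => ?_
  rw [tsub_le_iff_left, ← tsub_le_iff_right]
  exact le_infHull fun n A hA => by
    rw [tsub_le_iff_right]; exact key n A hA m A' hA'

lemma sum_supHull_le (F : Set Ω → ℝ≥0∞) {ι : Type*} [Fintype ι] {A : ι → Set Ω} {B : Set Ω}
    (h : IsPartitionOf A B) : ∑ i, supHull F (A i) ≤ supHull F B := by
  classical
  have key : ∀ t : Finset ι, ∑ i ∈ t, supHull F (A i) ≤ supHull F (⋃ i ∈ t, A i) := by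
    intro t
    induction t using Finset.induction_on with
    | empty => simp
    | insert a t ha ih =>
      rw [Finset.sum_insert ha, Finset.set_biUnion_insert]
      refine (add_le_add_right ih _).trans (supHull_add_le F ?_ (h.measurableSet a)
        (Finset.measurableSet_biUnion t fun i _ => h.measurableSet i))
      exact disjoint_iUnion₂_right.2 fun i hi =>
        h.pairwise_disjoint (ne_of_mem_of_not_mem hi ha).symm
  simpa [h.iUnion_eq] using key Finset.univ

lemma infHull_le_sum_infHull (F : Set Ω → ℝ≥0∞) (hF : F ∅ = 0) {ι : Type*} [Fintype ι]
    {A : ι → Set Ω} {B : Set Ω} (h : IsPartitionOf A B) :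
    infHull F B ≤ ∑ i, infHull F (A i) := by
  classical
  have key : ∀ t : Finset ι, infHull F (⋃ i ∈ t, A i) ≤ ∑ i ∈ t, infHull F (A i) := by
    intro t
    induction t using Finset.induction_on with
    | empty => simpa [hF] using infHull_le_self F (MeasurableSet.empty (α := Ω))
    | insert a t ha ih =>
      rw [Finset.sum_insert ha, Finset.set_biUnion_insert]
      refine (infHull_union_le F ?_).trans (add_le_add_right ih _)
      exact disjoint_iUnion₂_right.2 fun i hi =>
        h.pairwise_disjoint (ne_of_mem_of_not_mem hi ha).symm
  simpa [h.iUnion_eq] using key Finset.univ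

/-- Minkowski's inequality for finitely many summands. -/
lemma ennreal_Lp_sum_le {ι κ : Type*} (t : Finset ι) (u : Finset κ) (f : ι → κ → ℝ≥0∞) {s : ℝ}
    (hs : 1 ≤ s) :
    (∑ j ∈ u, (∑ i ∈ t, f i j) ^ s) ^ (1 / s) ≤ ∑ i ∈ t, (∑ j ∈ u, f i j ^ s) ^ (1 / s) := by
  classical
  have hs0 : 0 < s := by linarith
  induction t using Finset.induction_on with
  | empty => simp [hs0]
  | insert a t ha ih =>
    simp only [Finset.sum_insert ha]
    exact (ENNReal.Lp_add_le u (f a) (fun j => ∑ i ∈ t, f i j) hs).trans (add_le_add_right ih _)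

/-- The set function `Φ` is subadditive on finite measurable partitions up to the factor `c`. -/
def CrudelySubadditive (c : ℝ≥0∞) (Φ : Set Ω → ℝ≥0∞) : Prop :=
  ∀ (n : ℕ) (A : Fin n → Set Ω) (B : Set Ω), IsPartitionOf A B → Φ B ≤ c * ∑ i, Φ (A i)

/-- The set function `Φ ^ s` is superadditive on finite measurable partitions up to the
factor `d ^ s`. -/
def CrudelySuperadditive (s : ℝ) (d : ℝ≥0∞) (Φ : Set Ω → ℝ≥0∞) : Prop :=
  ∀ (n : ℕ) (A : Fin n → Set Ω) (B : Set Ω), IsPartitionOf A B →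
    (∑ i, Φ (A i) ^ s) ^ (1 / s) ≤ d * Φ B

lemma CrudelySubadditive.le {c : ℝ≥0∞} {Φ : Set Ω → ℝ≥0∞} (h : CrudelySubadditive c Φ)
    {ι : Type*} [Fintype ι] {A : ι → Set Ω} {B : Set Ω} (hA : IsPartitionOf A B) :
    Φ B ≤ c * ∑ i, Φ (A i) := by
  have e := (Fintype.equivFin ι).symm
  rw [← e.sum_comp]
  exact h _ _ B (hA.comp_equiv e)

lemma CrudelySuperadditive.le {s : ℝ} {d : ℝ≥0∞} {Φ : Set Ω → ℝ≥0∞}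
    (h : CrudelySuperadditive s d Φ) {ι : Type*} [Fintype ι] {A : ι → Set Ω} {B : Set Ω}
    (hA : IsPartitionOf A B) : (∑ i, Φ (A i) ^ s) ^ (1 / s) ≤ d * Φ B := by
  have e := (Fintype.equivFin ι).symm
  rw [← e.sum_comp]
  exact h _ _ B (hA.comp_equiv e)

/-- For a partition C of B, bound each Φ(C_j) by c ∑_i Φ(A_i ∩ C_j). Minkowski's inequality takes
the sum over i outside the ℓ^s norm in j, and the sets A_i ∩ C_j partition A_i. -/
lemma CrudelySubadditive.supHull {s : ℝ} (hs : 1 ≤ s) {c : ℝ≥0∞} {Φ : Set Ω → ℝ≥0∞}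
    (h : CrudelySubadditive c Φ) :
    CrudelySubadditive c fun B => supHull (fun A => Φ A ^ s) B ^ (1 / s) := by
  have hs0 : 0 < s := by linarith
  intro n A B hA
  rw [one_div, ENNReal.rpow_inv_le_iff hs0]
  refine supHull_le fun m C hC => ?_
  rw [← ENNReal.rpow_inv_le_iff hs0, ← one_div]
  have hAC : ∀ j, Φ (C j) ≤ c * ∑ i, Φ (A i ∩ C j) := fun j =>
    h _ _ _ (hA.inter (hC.measurableSet j) (hC.subset j))
  calc (∑ j, Φ (C j) ^ s) ^ (1 / s)
      ≤ (∑ j, (∑ i, c * Φ (A i ∩ C j)) ^ s) ^ (1 / s) := by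
        gcongr with j
        exact (hAC j).trans_eq (Finset.mul_sum _ _ _)
    _ ≤ ∑ i, (∑ j, (c * Φ (A i ∩ C j)) ^ s) ^ (1 / s) := ennreal_Lp_sum_le _ _ _ hs
    _ = c * ∑ i, (∑ j, Φ (A i ∩ C j) ^ s) ^ (1 / s) := by
        simp_rw [ENNReal.mul_rpow_of_nonneg _ _ hs0.le, ← Finset.mul_sum,
          ENNReal.mul_rpow_of_nonneg _ _ (one_div_nonneg.2 hs0.le), one_div,
          ENNReal.rpow_rpow_inv hs0.ne', ← Finset.mul_sum]
    _ ≤ c * ∑ i, _root_.supHull (fun A => Φ A ^ s) (A i) ^ (1 / s) := by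
        gcongr with i
        have := sum_le_supHull (fun A => Φ A ^ s) (hC.inter (hA.measurableSet i) (hA.subset i))
        simpa only [inter_comm (A i)] using this

/-- The same double partition and Minkowski's inequality, with the lower estimate applied inside
each C_j. -/
lemma CrudelySuperadditive.infHull {s : ℝ} (hs : 1 ≤ s) {d : ℝ≥0∞} (hd0 : d ≠ 0) (hd : d ≠ ∞)
    {Φ : Set Ω → ℝ≥0∞} (h : CrudelySuperadditive s d Φ) :
    CrudelySuperadditive s d (infHull Φ) := by
  have hs0 : 0 < s := by linarith
  intro n A B hA
  refine le_mul_infHull hd0 hd fun m C hC => ?_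
  calc (∑ i, _root_.infHull Φ (A i) ^ s) ^ (1 / s)
      ≤ (∑ i, (∑ j, Φ (C j ∩ A i)) ^ s) ^ (1 / s) := by
        gcongr with i
        exact infHull_le_sum Φ (hC.inter (hA.measurableSet i) (hA.subset i))
    _ ≤ ∑ j, (∑ i, Φ (C j ∩ A i) ^ s) ^ (1 / s) := ennreal_Lp_sum_le _ _ _ hs
    _ ≤ ∑ j, d * Φ (C j) := by
        gcongr with j
        have := h _ _ _ (hA.inter (hC.measurableSet j) (hC.subset j))
        simpa only [inter_comm (C j)] using this
    _ = d * ∑ j, Φ (C j) := by rw [Finset.mul_sum]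

lemma crudelySuperadditive_supHull {s : ℝ} (hs : 0 < s) (F : Set Ω → ℝ≥0∞) :
    CrudelySuperadditive s 1 fun B => supHull F B ^ (1 / s) := by
  intro n A B hA
  simp_rw [one_mul, one_div, ENNReal.rpow_inv_rpow hs.ne']
  gcongr
  exact sum_supHull_le F hA

lemma crudelySubadditive_infHull {F : Set Ω → ℝ≥0∞} (hF : F ∅ = 0) :
    CrudelySubadditive 1 (infHull F) := by
  intro n A B hA
  rw [one_mul]
  exact infHull_le_sum_infHull F hF hA

lemma CrudelySubadditive.le_mul_infHull {c : ℝ≥0∞} (hc0 : c ≠ 0) (hc : c ≠ ∞)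
    {Φ : Set Ω → ℝ≥0∞} (h : CrudelySubadditive c Φ) (B : Set Ω) : Φ B ≤ c * _root_.infHull Φ B :=
  _root_.le_mul_infHull hc0 hc fun n A hA => h n A B hA

lemma CrudelySuperadditive.supHull_le {s : ℝ} (hs : 0 < s) {d : ℝ≥0∞} {Φ : Set Ω → ℝ≥0∞}
    (h : CrudelySuperadditive s d Φ) (B : Set Ω) :
    supHull (fun A => Φ A ^ s) B ≤ (d * Φ B) ^ s :=
  _root_.supHull_le fun n A hA => by
    rw [← ENNReal.rpow_inv_le_iff hs, ← one_div]
    exact h n A B hA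

lemma CrudelySubadditive.union_le {Φ : Set Ω → ℝ≥0∞} (h : CrudelySubadditive 1 Φ) {B B' : Set Ω}
    (hB : MeasurableSet B) (hB' : MeasurableSet B') (hd : Disjoint B B') :
    Φ (B ∪ B') ≤ Φ B + Φ B' := by
  simpa using h.le (IsPartitionOf.bool hB hB' hd)

lemma CrudelySuperadditive.le_union {s : ℝ} (hs : 0 < s) {Φ : Set Ω → ℝ≥0∞}
    (h : CrudelySuperadditive s 1 Φ) {B B' : Set Ω}
    (hB : MeasurableSet B) (hB' : MeasurableSet B') (hd : Disjoint B B') :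
    Φ B ^ s + Φ B' ^ s ≤ Φ (B ∪ B') ^ s := by
  have := h.le (IsPartitionOf.bool hB hB' hd)
  rw [one_mul, one_div, ENNReal.rpow_inv_le_iff hs] at this
  simpa using this

lemma CrudelySuperadditive.mono {s : ℝ} (hs : 0 < s) {Φ : Set Ω → ℝ≥0∞}
    (h : CrudelySuperadditive s 1 Φ) {B B' : Set Ω}
    (hB : MeasurableSet B) (hB' : MeasurableSet B') (hBB' : B ⊆ B') : Φ B ≤ Φ B' := by
  have := h.le_union hs hB (hB'.diff hB) disjoint_sdiff_right
  rw [union_sdiff_cancel hBB'] at this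
  exact (ENNReal.rpow_le_rpow_iff hs).1 (le_self_add.trans this)

end Hulls

/-! ### From finite algebras to countably additive measures. -/

section Limits

universe u

/-- A finitely additive set function defined on all subsets. -/
structure IsFinitelyAdditive {Ω : Type*} (m : Set Ω → ℝ≥0∞) : Prop where
  empty : m ∅ = 0
  inter_add_diff : ∀ t s, m (t ∩ s) + m (t \ s) = m t

namespace IsFinitelyAdditive

variable {Ω : Type*} {m : Set Ω → ℝ≥0∞}

lemma mono (h : IsFinitelyAdditive m) {s t : Set Ω} (hst : s ⊆ t) : m s ≤ m t := by
  rw [← h.inter_add_diff t s, inter_eq_right.2 hst]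
  exact le_self_add

lemma union_le (h : IsFinitelyAdditive m) (s t : Set Ω) : m (s ∪ t) ≤ m s + m t := by
  rw [← h.inter_add_diff (s ∪ t) s]
  exact add_le_add (h.mono inter_subset_right) (h.mono (by simp))

lemma accumulate_le (h : IsFinitelyAdditive m) (t : ℕ → Set Ω) (n : ℕ) :
    m (accumulate t n) ≤ ∑ i ∈ Finset.range (n + 1), m (t i) := by
  induction n with
  | zero => simp
  | succ n ih =>
    rw [accumulate_succ, Finset.sum_range_succ]
    exact (h.union_le _ _).trans (add_le_add_left ih _)

end IsFinitelyAdditive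

/-- Finite additivity is a closed condition in a product of copies of the compact space [0, ∞],
since addition there is continuous. -/
lemma isCompact_isFinitelyAdditive (Ω : Type*) :
    IsCompact {m : Set Ω → ℝ≥0∞ | IsFinitelyAdditive m} := by
  have : {m : Set Ω → ℝ≥0∞ | IsFinitelyAdditive m} = {m | m ∅ = 0} ∩
      ⋂ t, ⋂ s, {m : Set Ω → ℝ≥0∞ | m (t ∩ s) + m (t \ s) = m t} := by
    ext m
    simp only [mem_ofPred_eq, mem_inter_iff, mem_iInter]
    exact ⟨fun h => ⟨h.empty, h.inter_add_diff⟩, fun h => ⟨h.1, h.2⟩⟩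
  rw [this]
  refine IsClosed.isCompact ((isClosed_eq (continuous_apply _) continuous_const).inter
    (isClosed_iInter fun t => isClosed_iInter fun s => isClosed_eq ?_ (continuous_apply _)))
  exact (continuous_apply (t ∩ s)).add (continuous_apply (t \ s))

lemma exists_isFinitelyAdditive_forall {Ω ι : Type*} (S : ι → Set Ω) (C : ι → Set ℝ≥0∞)
    (hC : ∀ i, IsClosed (C i))
    (h : ∀ u : Finset ι, ∃ m : Set Ω → ℝ≥0∞, IsFinitelyAdditive m ∧ ∀ i ∈ u, m (S i) ∈ C i) :
    ∃ m : Set Ω → ℝ≥0∞, IsFinitelyAdditive m ∧ ∀ i, m (S i) ∈ C i := by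
  obtain ⟨m, hm, hm'⟩ := (isCompact_isFinitelyAdditive Ω).inter_iInter_nonempty
    (fun i => {m : Set Ω → ℝ≥0∞ | m (S i) ∈ C i})
    (fun i => (hC i).preimage (continuous_apply (S i)))
    (fun u => by
      obtain ⟨m, hm, hm'⟩ := h u
      exact ⟨m, hm, by simpa using hm'⟩)
  exact ⟨m, hm, by simpa using hm'⟩

/-- Finitely many measurable sets are pulled back from a finite quotient, with a section. -/
lemma exists_finite_quotient {Ω : Type u} [MeasurableSpace Ω] (𝓕 : Finset (Set Ω))
    (h𝓕 : ∀ A ∈ 𝓕, MeasurableSet A) :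
    ∃ (J : Type u) (_ : Fintype J) (c : Ω → J) (x : J → Ω), (∀ j, c (x j) = j) ∧
      (∀ T : Set J, MeasurableSet (c ⁻¹' T)) ∧ ∀ A ∈ 𝓕, ∃ T : Set J, c ⁻¹' T = A := by
  classical
  set C : Ω → ({A // A ∈ 𝓕} → Prop) := fun ω A => ω ∈ A.1
  have hCm : Measurable C := measurable_pi_lambda _ fun A => measurableSet_setOfPred.1 (h𝓕 A.1 A.2)
  refine ⟨range C, Fintype.ofFinite _, rangeFactorization C, fun j => j.2.choose, fun j =>
    Subtype.ext j.2.choose_spec, fun T => ?_, fun A hA =>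
    ⟨{j | j.1 ⟨A, hA⟩}, by ext ω; simp [rangeFactorization, C]⟩⟩
  have : rangeFactorization C ⁻¹' T = C ⁻¹' (Subtype.val '' T) := by
    ext ω
    simp [rangeFactorization]
  rw [this]
  exact hCm (Set.toFinite _).measurableSet

/-- The sum of the point masses `w j` at the points `x j`. -/
noncomputable def pointMasses {Ω J : Type*} [Fintype J] (x : J → Ω) (w : J → ℝ) (B : Set Ω) :
    ℝ≥0∞ :=
  ∑ j, B.indicator (fun _ => ENNReal.ofReal (w j)) (x j)

lemma isFinitelyAdditive_pointMasses {Ω J : Type*} [Fintype J] (x : J → Ω) (w : J → ℝ) :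
    IsFinitelyAdditive (pointMasses x w) where
  empty := by simp [pointMasses]
  inter_add_diff t s := by
    simp only [pointMasses, ← Finset.sum_add_distrib]
    refine Finset.sum_congr rfl fun j _ => ?_
    by_cases ht : x j ∈ t <;> by_cases hs : x j ∈ s <;> simp [ht, hs]

lemma pointMasses_preimage {Ω J : Type*} [Fintype J] {c : Ω → J} {x : J → Ω}
    (hx : ∀ j, c (x j) = j) {w : J → ℝ} (hw : ∀ j, 0 ≤ w j) (T : Finset J) :
    pointMasses x w (c ⁻¹' T) = ENNReal.ofReal (∑ j ∈ T, w j) := by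
  classical
  rw [ENNReal.ofReal_sum_of_nonneg fun j _ => hw j]
  simp [pointMasses, indicator_apply, hx, Finset.sum_ite_mem]

variable {Ω : Type u} [MeasurableSpace Ω]

/-- An exact submeasure with a lower `s`-estimate dominates a finitely additive measure of
comparable total mass. -/
theorem exists_isFinitelyAdditive_le {s : ℝ} (hs : 1 ≤ s) {χ : Set Ω → ℝ≥0∞}
    (hfin : χ univ ≠ ∞) (hsub : CrudelySubadditive 1 χ) (hsup : CrudelySuperadditive s 1 χ) :
    ∃ m : Set Ω → ℝ≥0∞, IsFinitelyAdditive m ∧ (∀ A, MeasurableSet A → m A ≤ χ A) ∧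
      ENNReal.ofReal (kConst s) * χ univ ≤ m univ := by
  classical
  have hs0 : 0 < s := by linarith
  have hfin' : ∀ A, MeasurableSet A → χ A ≠ ∞ := fun A hA =>
    ne_top_of_le_ne_top hfin (hsup.mono hs0 hA .univ (subset_univ A))
  obtain ⟨m, hm, hm'⟩ := exists_isFinitelyAdditive_forall
    (fun A : {A : Set Ω // MeasurableSet A} => A.1)
    -- The lower bound on the total mass is attached as an extra closed condition to the index A =
    -- `univ`.
    (fun A => Iic (χ A.1) ∩ ⋂ _ : A.1 = univ, Ici (ENNReal.ofReal (kConst s) * χ univ))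
    (fun A => isClosed_Iic.inter (isClosed_iInter fun _ => isClosed_Ici))
    (fun u => by
      obtain ⟨J, _, c, x, hx, hc, hcu⟩ := exists_finite_quotient (u.image Subtype.val)
        (fun A hA => by
          obtain ⟨B, -, rfl⟩ := Finset.mem_image.1 hA
          exact B.2)
      have hdis : ∀ {T U : Finset J}, Disjoint T U → Disjoint (c ⁻¹' (T : Set J)) (c ⁻¹' U) :=
        fun h => (Finset.disjoint_coe.2 h).preimage c
      obtain ⟨w, hw, hwK⟩ := exists_large_dominatedWeights
        (fun T : Finset J => (χ (c ⁻¹' T)).toReal) hs (fun T => ENNReal.toReal_nonneg)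
        (fun T U hTU => by
          rw [Finset.coe_union, preimage_union, ← ENNReal.toReal_add (hfin' _ (hc _))
            (hfin' _ (hc _))]
          exact ENNReal.toReal_mono (ENNReal.add_ne_top.2 ⟨hfin' _ (hc _), hfin' _ (hc _)⟩)
            (hsub.union_le (hc _) (hc _) (hdis hTU)))
        (fun T U hTU => by
          have hp : ∀ T : Set J, χ (c ⁻¹' T) ^ s ≠ ∞ := fun T =>
            ENNReal.rpow_ne_top_of_nonneg hs0.le (hfin' _ (hc T))
          rw [Finset.coe_union, preimage_union, ENNReal.toReal_rpow, ENNReal.toReal_rpow,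
            ENNReal.toReal_rpow, ← ENNReal.toReal_add (hp _) (hp _)]
          exact ENNReal.toReal_mono (by simpa using hp (T ∪ U))
            (hsup.le_union hs0 (hc _) (hc _) (hdis hTU)))
      refine ⟨pointMasses x w, isFinitelyAdditive_pointMasses x w, fun A hA =>
        ⟨?_, mem_iInter.2 fun hAu => ?_⟩⟩
      · obtain ⟨T, hT⟩ := hcu A.1 (Finset.mem_image_of_mem _ hA)
        rw [← hT, ← coe_toFinset T, mem_Iic, pointMasses_preimage hx hw.1]
        exact ENNReal.ofReal_le_of_le_toReal (hw.2 _)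
      · have : A.1 = c ⁻¹' ((Finset.univ : Finset J) : Set J) := by simp [hAu]
        rw [mem_Ici, this, pointMasses_preimage hx hw.1, ← ENNReal.ofReal_toReal hfin,
          ← ENNReal.ofReal_mul (kConst_pos hs0).le]
        exact ENNReal.ofReal_le_ofReal (by simpa using hwK))
  exact ⟨m, hm, fun A hA => (hm' ⟨A, hA⟩).1, mem_iInter.1 (hm' ⟨univ, .univ⟩).2 rfl⟩

/-- The `s`-th power of an exact submeasure with a lower `s`-estimate is dominated by a finitely
additive measure of comparable total mass. -/
theorem exists_le_isFinitelyAdditive {s : ℝ} (hs : 1 ≤ s) {χ : Set Ω → ℝ≥0∞}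
    (hfin : χ univ ≠ ∞) (hsub : CrudelySubadditive 1 χ) (hsup : CrudelySuperadditive s 1 χ) :
    ∃ m : Set Ω → ℝ≥0∞, IsFinitelyAdditive m ∧ (∀ A, MeasurableSet A → χ A ^ s ≤ m A) ∧
      m univ ≤ ENNReal.ofReal (kConst (1 / s)) * χ univ ^ s := by
  classical
  have hs0 : 0 < s := by linarith
  have hfin' : ∀ A, MeasurableSet A → χ A ≠ ∞ := fun A hA =>
    ne_top_of_le_ne_top hfin (hsup.mono hs0 hA .univ (subset_univ A))
  have hfins : ∀ A, MeasurableSet A → χ A ^ s ≠ ∞ := fun A hA =>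
    ENNReal.rpow_ne_top_of_nonneg hs0.le (hfin' A hA)
  obtain ⟨m, hm, hm'⟩ := exists_isFinitelyAdditive_forall
    (fun A : {A : Set Ω // MeasurableSet A} => A.1)
    (fun A => Ici (χ A.1 ^ s) ∩
      ⋂ _ : A.1 = univ, Iic (ENNReal.ofReal (kConst (1 / s)) * χ univ ^ s))
    (fun A => isClosed_Ici.inter (isClosed_iInter fun _ => isClosed_Iic))
    (fun u => by
      obtain ⟨J, _, c, x, hx, hc, hcu⟩ := exists_finite_quotient (u.image Subtype.val)
        (fun A hA => by
          obtain ⟨B, -, rfl⟩ := Finset.mem_image.1 hA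
          exact B.2)
      have hdis : ∀ {T U : Finset J}, Disjoint T U → Disjoint (c ⁻¹' (T : Set J)) (c ⁻¹' U) :=
        fun h => (Finset.disjoint_coe.2 h).preimage c
      -- For θ = χ^s and r = 1/s, superadditivity of θ is the lower s-estimate of χ and
      -- subadditivity of θ^r is that of χ.
      obtain ⟨w, hw, hwK⟩ := exists_small_dominatingWeights
        (fun T : Finset J => (χ (c ⁻¹' T) ^ s).toReal) (r := 1 / s) (by positivity)
        ((div_le_one hs0).2 hs) (fun T => ENNReal.toReal_nonneg)
        (fun T U hTU => by
          rw [Finset.coe_union, preimage_union, ← ENNReal.toReal_add (hfins _ (hc _))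
            (hfins _ (hc _))]
          exact ENNReal.toReal_mono (by simpa using hfins _ (hc (T ∪ U)))
            (hsup.le_union hs0 (hc _) (hc _) (hdis hTU)))
        (fun T U hTU => by
          simp only [ENNReal.toReal_rpow, one_div, ENNReal.rpow_rpow_inv hs0.ne']
          rw [Finset.coe_union, preimage_union, ← ENNReal.toReal_add (hfin' _ (hc _))
            (hfin' _ (hc _))]
          exact ENNReal.toReal_mono (ENNReal.add_ne_top.2 ⟨hfin' _ (hc _), hfin' _ (hc _)⟩)
            (hsub.union_le (hc _) (hc _) (hdis hTU)))
      refine ⟨pointMasses x w, isFinitelyAdditive_pointMasses x w, fun A hA =>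
        ⟨?_, mem_iInter.2 fun hAu => ?_⟩⟩
      · obtain ⟨T, hT⟩ := hcu A.1 (Finset.mem_image_of_mem _ hA)
        rw [← hT, ← coe_toFinset T, mem_Ici, pointMasses_preimage hx hw.1]
        exact (ENNReal.le_ofReal_iff_toReal_le (hfins _ (hc _))
          (Finset.sum_nonneg fun j _ => hw.1 j)).2 (hw.2 _ (Finset.subset_univ _))
      · have : A.1 = c ⁻¹' ((Finset.univ : Finset J) : Set J) := by simp [hAu]
        rw [mem_Iic, this, pointMasses_preimage hx hw.1, ← ENNReal.ofReal_toReal (hfins _ .univ),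
          ← ENNReal.ofReal_mul (kConst_pos (by positivity)).le]
        exact ENNReal.ofReal_le_ofReal (by simpa using hwK))
  exact ⟨m, hm, fun A hA => (hm' ⟨A, hA⟩).1, mem_iInter.1 (hm' ⟨univ, .univ⟩).2 rfl⟩

/-- The countably additive part of a finitely additive set function. -/
theorem IsFinitelyAdditive.exists_measure_le {m : Set Ω → ℝ≥0∞} (hm : IsFinitelyAdditive m) :
    ∃ μ : Measure Ω, (∀ A, MeasurableSet A → μ A ≤ m A) ∧
      ∀ A, MeasurableSet A → ∀ c : ℝ≥0∞,
        (∀ S : ℕ → Set Ω, (∀ n, MeasurableSet (S n)) → Monotone S → ⋃ n, S n = A →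
          c ≤ ⨆ n, m (S n)) → c ≤ μ A := by
  classical
  -- The value ∞ makes non-measurable covering sets irrelevant. For a measurable cover t of A, the
  -- sets A ∩ (t_0 ∪ … ∪ t_n) increase to A and have m-mass at most ∑ m(t_i).
  set m' : Set Ω → ℝ≥0∞ := fun A => if MeasurableSet A then m A else ∞ with hm'
  have h0 : m' ∅ = 0 := by simp [hm', hm.empty]
  have hcar : ‹MeasurableSpace Ω› ≤ (OuterMeasure.ofFunction m' h0).caratheodory := by
    intro A hA
    refine OuterMeasure.ofFunction_caratheodory fun t => ?_
    by_cases ht : MeasurableSet t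
    · simp only [hm', ht, ht.inter hA, ht.diff hA, if_true, hm.inter_add_diff, le_refl]
    · simp [hm', ht]
  refine ⟨(OuterMeasure.ofFunction m' h0).toMeasure hcar, fun A hA => ?_, fun A hA c hc => ?_⟩
  · rw [toMeasure_apply _ _ hA]
    exact (OuterMeasure.ofFunction_le A).trans_eq (if_pos hA)
  · rw [toMeasure_apply _ _ hA, OuterMeasure.ofFunction_apply]
    refine le_iInf₂ fun t ht => ?_
    by_cases htm : ∀ n, MeasurableSet (t n)
    · refine (hc (fun n => A ∩ accumulate t n)
        (fun n => hA.inter (MeasurableSet.biUnion (Set.to_countable _) fun i _ => htm i))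
        (fun i j hij => inter_subset_inter_right A (monotone_accumulate hij)) ?_).trans ?_
      · rw [← inter_iUnion, iUnion_accumulate, inter_eq_left.2 ht]
      · refine iSup_le fun n => (hm.mono inter_subset_right).trans
          ((hm.accumulate_le t n).trans ?_)
        refine le_trans (Finset.sum_le_sum fun i _ => ?_) (ENNReal.sum_le_tsum _)
        simp [hm', htm i]
    · push Not at htm
      obtain ⟨n, hn⟩ := htm
      refine le_trans ?_ (ENNReal.le_tsum n)
      simp [hm', hn]

end Limits

/-! ### The quasinorm as a set function, and order continuity. -/

section Quasinorm

variable {Ω : Type*} [MeasurableSpace Ω] {N : (Ω → ℝ) → ℝ≥0∞}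

namespace IsAdmissibleQuasinorm

lemma zero (hN : IsAdmissibleQuasinorm N) : N (fun _ => 0) = 0 := by
  simpa using hN.smul 0 (fun _ => 0) measurable_const

lemma indicator_mono (hN : IsAdmissibleQuasinorm N) {g : Ω → ℝ} (hg : Measurable g)
    {A B : Set Ω} (hA : MeasurableSet A) (hB : MeasurableSet B) (hAB : A ⊆ B) :
    N (A.indicator g) ≤ N (B.indicator g) := by
  refine hN.mono _ _ (hg.indicator hA) (hg.indicator hB) fun ω => ?_
  by_cases h : ω ∈ A
  · simp [h, hAB h]
  · simp [h]

lemma indicator_le (hN : IsAdmissibleQuasinorm N) {g : Ω → ℝ} (hg : Measurable g)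
    {A : Set Ω} (hA : MeasurableSet A) : N (A.indicator g) ≤ N g := by
  simpa using hN.indicator_mono hg hA .univ (subset_univ A)

lemma mul_indicator_le (hN : IsAdmissibleQuasinorm N) {f g : Ω → ℝ} (hf : Measurable f)
    (hg : Measurable g) (hf0 : ∀ ω, 0 ≤ f ω) {A : Set Ω} (hA : MeasurableSet A) {t : ℝ}
    (ht : 0 ≤ t) (h : ∀ ω ∈ A, t * f ω ≤ |g ω|) :
    ENNReal.ofReal t * N (A.indicator f) ≤ N (A.indicator g) := by
  have := hN.smul t _ (hf.indicator hA)
  rw [abs_of_nonneg ht] at this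
  rw [← this]
  refine hN.mono _ _ ((hf.indicator hA).const_mul t) (hg.indicator hA) fun ω => ?_
  by_cases hω : ω ∈ A
  · simpa [hω, abs_of_nonneg (mul_nonneg ht (hf0 ω))] using h ω hω
  · simp [hω]

lemma indicator_le_mul (hN : IsAdmissibleQuasinorm N) {f g : Ω → ℝ} (hf : Measurable f)
    (hg : Measurable g) (hf0 : ∀ ω, 0 ≤ f ω) {A : Set Ω} (hA : MeasurableSet A) {t : ℝ}
    (ht : 0 ≤ t) (h : ∀ ω ∈ A, |g ω| ≤ t * f ω) :
    N (A.indicator g) ≤ ENNReal.ofReal t * N (A.indicator f) := by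
  have := hN.smul t _ (hf.indicator hA)
  rw [abs_of_nonneg ht] at this
  rw [← this]
  refine hN.mono _ _ (hg.indicator hA) ((hf.indicator hA).const_mul t) fun ω => ?_
  by_cases hω : ω ∈ A
  · simpa [hω, abs_of_nonneg (mul_nonneg ht (hf0 ω))] using h ω hω
  · simp [hω]

/-- The truncations min(|g|, n f) increase to |g| on A and have quasinorm zero there. This settles
the products ∞ · 0 in part (ii). -/
lemma indicator_eq_zero (hN : IsAdmissibleQuasinorm N) {f g : Ω → ℝ} (hf : Measurable f)
    (hg : Measurable g) (hf0 : ∀ ω, 0 ≤ f ω) {A : Set Ω} (hA : MeasurableSet A)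
    (hpos : ∀ ω ∈ A, 0 < f ω) (h0 : N (A.indicator f) = 0) : N (A.indicator g) = 0 := by
  set F : ℕ → Ω → ℝ := fun n => A.indicator fun ω => min |g ω| (n * f ω)
  have hgm : Measurable fun ω => |g ω| := hg.abs
  have hFm : ∀ n, Measurable (F n) := fun n => (hgm.min (hf.const_mul _)).indicator hA
  have hnn : ∀ (n : ℕ) (ω : Ω), 0 ≤ min |g ω| (n * f ω) := fun n ω =>
    le_min (abs_nonneg _) (mul_nonneg (Nat.cast_nonneg n) (hf0 ω))
  have hF0 : ∀ n, N (F n) = 0 := fun n => by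
    have hm : Measurable fun ω => min |g ω| (n * f ω) := hgm.min (hf.const_mul _)
    have := hN.indicator_le_mul hf hm hf0 hA (Nat.cast_nonneg n) fun ω _ => by
      rw [abs_of_nonneg (hnn n ω)]; exact min_le_right _ _
    rw [h0, mul_zero] at this
    exact le_antisymm this bot_le
  have hlim := hN.fatou F (A.indicator fun ω => |g ω|) hFm (hgm.indicator hA)
    (fun n ω => indicator_nonneg (fun ω _ => hnn n ω) ω)
    (fun ω n m hnm => indicator_le_indicator (min_le_min le_rfl (by
      gcongr
      exact hf0 ω)))
    (fun ω => by
      by_cases hω : ω ∈ A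
      · simp only [F, indicator_of_mem hω]
        refine tendsto_const_nhds.congr' ?_
        obtain ⟨k, hk⟩ := exists_nat_ge (|g ω| / f ω)
        filter_upwards [eventually_ge_atTop k] with n hn
        refine (min_eq_left ?_).symm
        rw [← div_le_iff₀ (hpos ω hω)]
        exact hk.trans (by exact_mod_cast hn)
      · simp only [F, indicator_of_notMem hω]
        exact tendsto_const_nhds)
  have h1 : N (A.indicator fun ω => |g ω|) = 0 :=
    tendsto_nhds_unique hlim (by simp only [hF0]; exact tendsto_const_nhds)
  refine le_antisymm (h1 ▸ hN.mono _ _ (hg.indicator hA) (hgm.indicator hA) fun ω => ?_) bot_le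
  by_cases hω : ω ∈ A <;> simp [hω]

lemma tendsto_indicator_diff (hN : IsAdmissibleQuasinorm N) {f : Ω → ℝ} (hf : Measurable f)
    (hf0 : ∀ ω, 0 ≤ f ω) {A : Set Ω} (hA : MeasurableSet A) {B : ℕ → Set Ω}
    (hB : ∀ n, MeasurableSet (B n)) (hanti : Antitone B) (hempty : ⋂ n, B n = ∅) :
    Tendsto (fun n => N ((A \ B n).indicator f)) atTop (𝓝 (N (A.indicator f))) := by
  refine hN.fatou _ _ (fun n => hf.indicator (hA.diff (hB n))) (hf.indicator hA)
    (fun n ω => indicator_nonneg (fun ω _ => hf0 ω) ω) (fun ω n m hnm =>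
      indicator_le_indicator_of_subset (sdiff_subset_sdiff_right (hanti hnm)) hf0 ω) fun ω => ?_
  refine tendsto_const_nhds.congr' ?_
  obtain ⟨k, hk⟩ : ∃ k, ω ∉ B k := by
    by_contra! h
    exact absurd (mem_iInter.2 h) (hempty ▸ notMem_empty ω)
  filter_upwards [eventually_ge_atTop k] with n hn
  have : ω ∉ B n := fun h => hk (hanti hn h)
  by_cases hω : ω ∈ A <;> simp [hω, this]

end IsAdmissibleQuasinorm

lemma IsPartitionOf.sum_indicator {n : ℕ} {A : Fin n → Set Ω} {B : Set Ω}
    (h : IsPartitionOf A B) (g : Ω → ℝ) : ∑ i, (A i).indicator g = B.indicator g := by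
  ext ω
  rw [Finset.sum_apply]
  by_cases hω : ω ∈ B
  · rw [← h.iUnion_eq] at hω
    obtain ⟨i, hi⟩ := mem_iUnion.1 hω
    rw [Finset.sum_eq_single i, indicator_of_mem hi, indicator_of_mem (h.subset i hi)]
    · intro j _ hj
      exact indicator_of_notMem (disjoint_left.1 (h.pairwise_disjoint hj.symm) hi) g
    · simp
  · rw [indicator_of_notMem hω]
    exact Finset.sum_eq_zero fun i _ => indicator_of_notMem (fun hi => hω (h.subset i hi)) g

lemma IsPartitionOf.disjoint_support {n : ℕ} {A : Fin n → Set Ω} {B : Set Ω}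
    (h : IsPartitionOf A B) (g : Ω → ℝ) : Pairwise fun i j =>
      Disjoint (Function.support ((A i).indicator g)) (Function.support ((A j).indicator g)) :=
  fun _ _ hij => (h.pairwise_disjoint hij).mono (support_indicator_subset)
    (support_indicator_subset)

lemma CrudeUpperEstimate.crudelySubadditive (hN : IsAdmissibleQuasinorm N) {p : ℝ} (hp : 0 < p)
    {a : ℝ≥0} (ha : CrudeUpperEstimate N p a) {g : Ω → ℝ} (hg : Measurable g) (hgN : N g < ∞) :
    CrudelySubadditive ((a : ℝ≥0∞) ^ p) fun A => N (A.indicator g) ^ p := by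
  intro n A B h
  have := ha n (fun i => (A i).indicator g) (fun i => hg.indicator (h.measurableSet i))
    (fun i => (hN.indicator_le hg (h.measurableSet i)).trans_lt hgN) (h.disjoint_support g)
  rw [h.sum_indicator] at this
  calc N (B.indicator g) ^ p ≤ (a * (∑ i, N ((A i).indicator g) ^ p) ^ (1 / p)) ^ p := by gcongr
    _ = _ := by
      rw [ENNReal.mul_rpow_of_nonneg _ _ hp.le, one_div, ENNReal.rpow_inv_rpow hp.ne']

lemma CrudeLowerEstimate.crudelySuperadditive (hN : IsAdmissibleQuasinorm N) {p q : ℝ}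
    (hp : 0 < p) (hq : 0 < q) {b : ℝ≥0} (hb : CrudeLowerEstimate N q b) {g : Ω → ℝ}
    (hg : Measurable g) (hgN : N g < ∞) :
    CrudelySuperadditive (q / p) ((b : ℝ≥0∞) ^ p) fun A => N (A.indicator g) ^ p := by
  intro n A B h
  have := hb n (fun i => (A i).indicator g) (fun i => hg.indicator (h.measurableSet i))
    (fun i => (hN.indicator_le hg (h.measurableSet i)).trans_lt hgN) (h.disjoint_support g)
  rw [h.sum_indicator] at this
  simp_rw [← ENNReal.rpow_mul, mul_div_cancel₀ q hp.ne']
  rw [← ENNReal.mul_rpow_of_nonneg _ _ hp.le]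
  calc _ = ((∑ i, N ((A i).indicator g) ^ q) ^ (1 / q)) ^ p := by
        rw [← ENNReal.rpow_mul]; congr 1; field_simp
    _ ≤ _ := by gcongr

/-- Order continuity of `A ↦ N (f 1_A)`: the lower estimate excludes infinitely many disjoint sets
of large size. -/
lemma iInf_indicator_rpow_eq_zero (hN : IsAdmissibleQuasinorm N) {p s : ℝ} (hp : 0 < p)
    (hs : 0 < s) {d : ℝ≥0∞} (hd : d ≠ ∞) {f : Ω → ℝ} (hf : Measurable f) (hf0 : ∀ ω, 0 ≤ f ω)
    (hfN : N f < ∞) (hsup : CrudelySuperadditive s d fun A => N (A.indicator f) ^ p)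
    {B : ℕ → Set Ω} (hB : ∀ n, MeasurableSet (B n)) (hanti : Antitone B)
    (hempty : ⋂ n, B n = ∅) : ⨅ n, N ((B n).indicator f) ^ p = 0 := by
  set F : Set Ω → ℝ≥0∞ := fun A => (N (A.indicator f) ^ p) ^ s
  set e := ⨅ n, supHull F (B n)
  have he : e ≠ ∞ := by
    refine ne_top_of_le_ne_top ?_ (iInf_le _ 0)
    refine ne_top_of_le_ne_top ?_ (hsup.supHull_le hs (B 0))
    refine ENNReal.rpow_ne_top_of_nonneg hs.le (ENNReal.mul_ne_top hd ?_)
    exact ENNReal.rpow_ne_top_of_nonneg hp.le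
      ((hN.indicator_le hf (hB 0)).trans_lt hfN).ne
  have key : ∀ n, F (B n) + e ≤ supHull F (B n) := by
    -- Superadditivity gives F(B_n \ B_m) + e ≤ `supHull F (B n)`; let m → ∞. Taking the infimum
    -- over n then yields x^s + e ≤ e with e finite, so x = 0.
    intro n
    have hlim : Tendsto (fun m => F (B n \ B m) + e) atTop (𝓝 (F (B n) + e)) :=
      Tendsto.add ((ENNReal.continuous_rpow_const.tendsto _).comp
        ((ENNReal.continuous_rpow_const.tendsto _).comp
          (hN.tendsto_indicator_diff hf hf0 (hB n) hB hanti hempty))) tendsto_const_nhds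
    refine le_of_tendsto' hlim fun m => ?_
    have h1 : e ≤ supHull F (B n ∩ B m) := by
      have : B n ∩ B m = B (max n m) := by
        rcases le_total n m with h | h
        · rw [max_eq_right h, inter_eq_right.2 (hanti h)]
        · rw [max_eq_left h, inter_eq_left.2 (hanti h)]
      rw [this]
      exact iInf_le _ _
    calc F (B n \ B m) + e ≤ supHull F (B n \ B m) + supHull F (B n ∩ B m) :=
          add_le_add (le_supHull_self F ((hB n).diff (hB m))) h1
      _ ≤ supHull F (B n \ B m ∪ B n ∩ B m) := supHull_add_le F
          (disjoint_sdiff_inter) ((hB n).diff (hB m)) ((hB n).inter (hB m))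
      _ = _ := by rw [sdiff_union_inter]
  set x := ⨅ n, N ((B n).indicator f) ^ p
  have hx : x ^ s + e ≤ e := le_iInf fun n => (add_le_add_left
    (ENNReal.rpow_le_rpow (iInf_le _ n) hs.le) e).trans (key n)
  have hx0 : x ^ s = 0 := by
    by_contra hne
    exact absurd hx (not_le.2 (by
      rw [add_comm]; exact ENNReal.lt_add_right he hne))
  exact (ENNReal.rpow_eq_zero_iff_of_pos hs).1 hx0

/-- Order continuity as a limiting argument: error terms on sets decreasing to ∅ may be dropped.
This preserves the required bounds when m is replaced by its countably additive part. -/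
lemma le_of_forall_le_add_indicator (hN : IsAdmissibleQuasinorm N) {p s : ℝ} (hp : 0 < p)
    (hs : 0 < s) {d e : ℝ≥0∞} (hd : d ≠ ∞) (he0 : e ≠ 0) (he : e ≠ ∞) {f : Ω → ℝ}
    (hf : Measurable f) (hf0 : ∀ ω, 0 ≤ f ω) (hfN : N f < ∞)
    (hsup : CrudelySuperadditive s d fun A => N (A.indicator f) ^ p)
    {B : ℕ → Set Ω} (hB : ∀ n, MeasurableSet (B n)) (hanti : Antitone B)
    (hempty : ⋂ n, B n = ∅) {x y : ℝ≥0∞} (h : ∀ n, x ≤ y + e * N ((B n).indicator f) ^ p) :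
    x ≤ y := by
  have h1 : x ≤ y + ⨅ n, e * N ((B n).indicator f) ^ p := by
    rw [← tsub_le_iff_left]
    exact le_iInf fun n => tsub_le_iff_left.2 (h n)
  rwa [← ENNReal.mul_iInf_of_ne he0 he,
    iInf_indicator_rpow_eq_zero hN hp hs hd hf hf0 hfN hsup hB hanti hempty, mul_zero,
    add_zero] at h1

end Quasinorm

/-! ### Part (i): the measure μ. -/

section Factorization

universe u

variable {Ω : Type u} [MeasurableSpace Ω] {N : (Ω → ℝ) → ℝ≥0∞}

lemma mul_supHull_le {F G : Set Ω → ℝ≥0∞} {t : ℝ≥0∞} {A : Set Ω}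
    (h : ∀ B ⊆ A, MeasurableSet B → t * F B ≤ G B) : t * supHull F A ≤ supHull G A := by
  simp only [supHull, ENNReal.mul_iSup]
  refine iSup_le fun n => iSup₂_le fun C hC => ?_
  rw [Finset.mul_sum]
  exact (Finset.sum_le_sum fun i _ => h _ (hC.subset i) (hC.measurableSet i)).trans
    (sum_le_supHull G hC)

lemma infHull_le_mul {F G : Set Ω → ℝ≥0∞} {t : ℝ≥0∞} (ht : t ≠ ∞) {A : Set Ω}
    (hA : MeasurableSet A) (h : ∀ B ⊆ A, MeasurableSet B → G B ≤ t * F B) :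
    infHull G A ≤ t * infHull F A := by
  rcases eq_or_ne t 0 with rfl | ht0
  · rw [zero_mul]
    exact (infHull_le_self G hA).trans ((h A subset_rfl hA).trans_eq (zero_mul _))
  refine le_mul_infHull ht0 ht fun n C hC => (infHull_le_sum G hC).trans ?_
  rw [Finset.mul_sum]
  exact Finset.sum_le_sum fun i _ => h _ (hC.subset i) (hC.measurableSet i)

lemma IsBorelPartition.isPartitionOf {n : ℕ} {A : Fin n → Set Ω} (h : IsBorelPartition A) :
    IsPartitionOf A univ :=
  ⟨h.measurableSet, h.pairwise_disjoint, h.iUnion_eq⟩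

lemma mul_rpow_iInf_le (hN : IsAdmissibleQuasinorm N) {f g : Ω → ℝ} (hf : Measurable f)
    (hg : Measurable g) (hf0 : ∀ ω, 0 ≤ f ω) {A B : Set Ω} (hBA : B ⊆ A) (hB : MeasurableSet B) :
    (⨅ ω ∈ A, ENNReal.ofReal |g ω / f ω|) * N (B.indicator f) ≤ N (B.indicator g) := by
  set t := ⨅ ω ∈ A, ENNReal.ofReal |g ω / f ω|
  have htle : ∀ ω ∈ A, t ≤ ENNReal.ofReal |g ω / f ω| := fun ω hω => iInf₂_le ω hω
  rcases B.eq_empty_or_nonempty with rfl | ⟨ω₀, hω₀⟩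
  -- If A is empty as well, the infimum is ∞ and the product is ∞ · 0.
  · have : N ((∅ : Set Ω).indicator f) = 0 := by
      rw [indicator_empty]; exact hN.zero
    rw [this, mul_zero]
    exact bot_le
  have ht : t ≠ ∞ := ne_top_of_le_ne_top ENNReal.ofReal_ne_top (htle ω₀ (hBA hω₀))
  rw [← ENNReal.ofReal_toReal ht]
  refine hN.mul_indicator_le hf hg hf0 hB ENNReal.toReal_nonneg fun ω hω => ?_
  have h1 : t.toReal ≤ |g ω / f ω| :=
    ENNReal.toReal_le_of_le_ofReal (abs_nonneg _) (htle ω (hBA hω))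
  rcases (hf0 ω).eq_or_lt with h | h
  · rw [← h, mul_zero]; exact abs_nonneg _
  · rwa [abs_div, abs_of_pos h, le_div_iff₀ h] at h1

lemma indicator_le_iSup_mul (hN : IsAdmissibleQuasinorm N) {f g : Ω → ℝ} (hf : Measurable f)
    (hg : Measurable g) (hf0 : ∀ ω, 0 ≤ f ω) {A B : Set Ω} (hBA : B ⊆ A) (hB : MeasurableSet B)
    (hpos : ∀ ω ∈ B, 0 < f ω) (ht : (⨆ ω ∈ A, ENNReal.ofReal |g ω / f ω|) ≠ ∞) :
    N (B.indicator g) ≤ (⨆ ω ∈ A, ENNReal.ofReal |g ω / f ω|) * N (B.indicator f) := by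
  set t := ⨆ ω ∈ A, ENNReal.ofReal |g ω / f ω|
  have htle : ∀ ω ∈ A, ENNReal.ofReal |g ω / f ω| ≤ t := fun ω hω =>
    le_iSup₂ (f := fun ω (_ : ω ∈ A) => ENNReal.ofReal |g ω / f ω|) ω hω
  rw [← ENNReal.ofReal_toReal ht]
  refine hN.indicator_le_mul hf hg hf0 hB ENNReal.toReal_nonneg fun ω hω => ?_
  have h1 : |g ω / f ω| ≤ t.toReal := (ENNReal.ofReal_le_iff_le_toReal ht).1 (htle ω (hBA hω))
  rwa [abs_div, abs_of_pos (hpos ω hω), div_le_iff₀ (hpos ω hω)] at h1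

lemma measurableSet_zero {f : Ω → ℝ} (hf : Measurable f) : MeasurableSet {ω | f ω = 0} :=
  hf (measurableSet_singleton 0)

lemma indicator_zeroSet {Ω : Type*} (f : Ω → ℝ) : {ω | f ω = 0}.indicator f = fun _ => 0 := by
  ext ω
  by_cases h : f ω = 0 <;> simp [h]

/-- Here ψ is the supremum hull of Φ_f and ρ = `infHull ψ` is exact in both senses, with ρ ≤ ψ ≤ cρ.
A measure below ρ of mass at least K ρ(Ω) ≥ K/c, once normalised, is at most (c/K) ψ; the factor d
enters only when the hull of Φ_g is bounded by N g. -/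
theorem exists_probability_lambdaNorm_le (hN : IsAdmissibleQuasinorm N)
    {p q : ℝ} (hp : 0 < p) (hpq : p < q) {a b : ℝ≥0}
    (ha : CrudeUpperEstimate N p a) (hb : CrudeLowerEstimate N q b)
    {f : Ω → ℝ} (hf : Measurable f) (hf0 : ∀ ω, 0 ≤ f ω) (hf1 : N f = 1) :
    ∃ μ : Measure Ω, IsProbabilityMeasure μ ∧ (∀ᵐ ω ∂μ, 0 < f ω) ∧
      ∀ g : Ω → ℝ, Measurable g → N g < ∞ →
        lambdaNorm p q μ (fun ω => g ω / f ω)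
          ≤ a * b * ENNReal.ofReal (kConst (q / p) ^ (-(1 / p))) * N g := by
  have hq : 0 < q := hp.trans hpq
  have hfN : N f < ∞ := hf1 ▸ ENNReal.one_lt_top
  set s := q / p with hsdef
  have hs : 1 ≤ s := (one_le_div hp).2 hpq.le
  have hs0 : 0 < s := by linarith
  set c : ℝ≥0∞ := (a : ℝ≥0∞) ^ p with hc
  set d : ℝ≥0∞ := (b : ℝ≥0∞) ^ p with hd
  have hctop : c ≠ ∞ := ENNReal.rpow_ne_top_of_nonneg hp.le ENNReal.coe_ne_top
  have hdtop : d ≠ ∞ := ENNReal.rpow_ne_top_of_nonneg hp.le ENNReal.coe_ne_top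
  set Φ : (Ω → ℝ) → Set Ω → ℝ≥0∞ := fun g A => N (A.indicator g) ^ p with hΦ
  have hΦuniv : Φ f univ = 1 := by simp [hΦ, hf1]
  have hΦsub : CrudelySubadditive c (Φ f) := ha.crudelySubadditive hN hp hf hfN
  have hΦsup : ∀ g, Measurable g → N g < ∞ → CrudelySuperadditive s d (Φ g) :=
    fun g hg hgN => hb.crudelySuperadditive hN hp hq hg hgN
  have hc0 : c ≠ 0 := by
    rintro h
    have := hΦsub.le (IsPartitionOf.unit MeasurableSet.univ)
    simp [hΦuniv, h] at this
  have hd0 : d ≠ 0 := by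
    rintro h
    have := (hΦsup f hf hfN).le (IsPartitionOf.unit MeasurableSet.univ)
    simp [hΦuniv, h] at this
  set S : (Ω → ℝ) → Set Ω → ℝ≥0∞ := fun g => supHull fun A => Φ g A ^ s
  set ψ : Set Ω → ℝ≥0∞ := fun B => S f B ^ (1 / s) with hψ
  have hψsub : CrudelySubadditive c ψ := hΦsub.supHull hs
  have hψsup : CrudelySuperadditive s 1 ψ := crudelySuperadditive_supHull hs0 _
  have hψΦ : ∀ B, ψ B ≤ d * Φ f B := fun B => by
    rw [hψ]; dsimp only
    rw [one_div, ENNReal.rpow_inv_le_iff hs0]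
    exact (hΦsup f hf hfN).supHull_le hs0 B
  have hΦempty : Φ f ∅ = 0 := by
    simp only [hΦ, indicator_empty]
    rw [hN.zero, ENNReal.zero_rpow_of_pos hp]
  have hψempty : ψ ∅ = 0 := le_antisymm ((hψΦ ∅).trans_eq (by rw [hΦempty, mul_zero])) bot_le
  have hρsub := crudelySubadditive_infHull hψempty
  have hρsup := hψsup.infHull hs one_ne_zero ENNReal.one_ne_top
  have hρψ : ∀ A, MeasurableSet A → infHull ψ A ≤ ψ A := fun A hA => infHull_le_self ψ hA
  have hρfin : infHull ψ univ ≠ ∞ := by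
    refine ne_top_of_le_ne_top ?_ ((hρψ _ .univ).trans (hψΦ univ))
    rw [hΦuniv, mul_one]; exact hdtop
  obtain ⟨m, hm, hmle, hmK⟩ := exists_isFinitelyAdditive_le hs hρfin hρsub hρsup
  obtain ⟨μ₀, hμm, hμ⟩ := hm.exists_measure_le
  have hμψ : ∀ A, MeasurableSet A → μ₀ A ≤ ψ A := fun A hA =>
    (hμm A hA).trans ((hmle A hA).trans (hρψ A hA))
  -- Along T_n increasing to Ω, the mass of m outside T_n is at most d Φ_f of the complement of T_n,
  -- an error removed by order continuity.
  have hμuniv : m univ ≤ μ₀ univ := by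
    refine hμ univ .univ _ fun T hT hTmono hTuniv => ?_
    refine le_of_forall_le_add_indicator hN hp hs0 hdtop hd0 hdtop hf hf0 hfN (hΦsup f hf hfN)
      (B := fun n => (T n)ᶜ) (fun n => (hT n).compl) (fun i j hij => compl_subset_compl.2
        (hTmono hij)) (by rw [← compl_iUnion, hTuniv, compl_univ]) fun n => ?_
    rw [← hm.inter_add_diff univ (T n), univ_inter, ← compl_eq_univ_sdiff]
    exact add_le_add (le_iSup (fun n => m (T n)) n) ((hmle _ (hT n).compl).trans
      ((hρψ _ (hT n).compl).trans (hψΦ _)))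
  set K : ℝ≥0∞ := ENNReal.ofReal (kConst s) with hK
  have hK0 : K ≠ 0 := (ENNReal.ofReal_pos.2 (kConst_pos hs0)).ne'
  have hKtop : K ≠ ∞ := ENNReal.ofReal_ne_top
  set M := μ₀ univ with hM
  have hKM : K ≤ c * M := by
    have h1 : 1 ≤ ψ univ := by
      rw [hψ]; dsimp only
      rw [one_div, ENNReal.le_rpow_inv_iff hs0]
      have := le_supHull_self (fun A => Φ f A ^ s) (MeasurableSet.univ (α := Ω))
      rwa [hΦuniv] at this
    have h2 := h1.trans (hψsub.le_mul_infHull hc0 hctop univ)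
    calc K = K * 1 := (mul_one _).symm
      _ ≤ K * (c * infHull ψ univ) := by gcongr
      _ = c * (K * infHull ψ univ) := by ring
      _ ≤ c * M := by gcongr; exact hmK.trans hμuniv
  have hM0 : M ≠ 0 := fun h => hK0 (le_antisymm (by simpa [h] using hKM) bot_le)
  have hMtop : M ≠ ∞ := by
    refine ne_top_of_le_ne_top ?_ ((hμψ univ .univ).trans (hψΦ univ))
    rw [hΦuniv, mul_one]; exact hdtop
  have hMinv : M⁻¹ ≤ c / K := by
    rw [ENNReal.le_div_iff_mul_le (Or.inl hK0) (Or.inl hKtop), mul_comm, ← div_eq_mul_inv]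
    exact ENNReal.div_le_of_le_mul hKM
  refine ⟨M⁻¹ • μ₀, ⟨by simp [← hM, ENNReal.inv_mul_cancel hM0 hMtop]⟩, ?_, fun g hg hgN => ?_⟩
  · rw [ae_iff, Measure.smul_apply, smul_eq_mul]
    have e : {ω | ¬0 < f ω} = {ω | f ω = 0} := by
      ext ω; exact ⟨fun h => le_antisymm (not_lt.1 h) (hf0 ω), fun h => h.not_gt⟩
    have h0 : Φ f {ω | f ω = 0} = 0 := by
      simp only [hΦ, indicator_zeroSet]
      rw [hN.zero, ENNReal.zero_rpow_of_pos hp]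
    have h1 := (hμψ _ (measurableSet_zero hf)).trans (hψΦ _)
    rw [h0, mul_zero] at h1
    rw [e, le_antisymm h1 bot_le, mul_zero]
  · rw [lambdaNorm, if_pos hpq]
    refine iSup₂_le fun n A => iSup_le fun hA => ?_
    have hA' := hA.isPartitionOf
    have hterm : ∀ i, (⨅ ω ∈ A i, ENNReal.ofReal |g ω / f ω|) ^ q * (M⁻¹ • μ₀) (A i) ^ s
        ≤ (c / K) ^ s * S g (A i) := by
      intro i
      set t := ⨅ ω ∈ A i, ENNReal.ofReal |g ω / f ω|
      have h1 : (M⁻¹ • μ₀) (A i) ^ s ≤ (c / K) ^ s * S f (A i) := by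
        have h3 : (M⁻¹ • μ₀) (A i) ≤ c / K * ψ (A i) := by
          rw [Measure.smul_apply, smul_eq_mul]
          exact mul_le_mul' hMinv (hμψ _ (hA.measurableSet i))
        refine (ENNReal.rpow_le_rpow h3 hs0.le).trans_eq ?_
        rw [ENNReal.mul_rpow_of_nonneg _ _ hs0.le, hψ]
        dsimp only
        rw [one_div, ENNReal.rpow_inv_rpow hs0.ne']
      -- Since ψ^s is a supremum over partitions, the pointwise bound t f ≤ |g|, which also holds at
      -- zeros of f, passes to it piece by piece.
      have h2 : t ^ q * S f (A i) ≤ S g (A i) := by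
        refine mul_supHull_le fun B hB hBm => ?_
        simp only [hΦ, hsdef, ← ENNReal.rpow_mul, mul_div_cancel₀ q hp.ne']
        rw [← ENNReal.mul_rpow_of_nonneg _ _ hq.le]
        exact ENNReal.rpow_le_rpow (mul_rpow_iInf_le hN hf hg hf0 hB hBm) hq.le
      calc _ ≤ t ^ q * ((c / K) ^ s * S f (A i)) := by gcongr
        _ = (c / K) ^ s * (t ^ q * S f (A i)) := by ring
        _ ≤ _ := by gcongr
    have hsum : ∑ i, (⨅ ω ∈ A i, ENNReal.ofReal |g ω / f ω|) ^ q * (M⁻¹ • μ₀) (A i) ^ s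
        ≤ (c / K * (d * N g ^ p)) ^ s := by
      refine (Finset.sum_le_sum fun i _ => hterm i).trans ?_
      rw [← Finset.mul_sum, ENNReal.mul_rpow_of_nonneg _ _ hs0.le]
      gcongr
      refine (sum_supHull_le _ hA').trans (((hΦsup g hg hgN).supHull_le hs0 univ).trans_eq ?_)
      simp [hΦ]
    calc _ ≤ ((c / K * (d * N g ^ p)) ^ s) ^ (1 / q) := by gcongr
      _ = (c / K * (d * N g ^ p)) ^ (1 / p) := by
        rw [← ENNReal.rpow_mul]; congr 1; rw [hsdef]; field_simp
      _ = _ := by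
        have hp' : (0 : ℝ) ≤ 1 / p := by positivity
        rw [ENNReal.mul_rpow_of_nonneg _ _ hp', ENNReal.mul_rpow_of_nonneg _ _ hp',
          ENNReal.div_rpow_of_nonneg _ _ hp', hc, hd, one_div, ENNReal.rpow_rpow_inv hp.ne',
          ENNReal.rpow_rpow_inv hp.ne', ENNReal.rpow_rpow_inv hp.ne',
          ← ENNReal.ofReal_rpow_of_pos (kConst_pos hs0), ENNReal.rpow_neg, div_eq_mul_inv]
        ring

end Factorization

/-! ### Part (ii): the measure λ. -/

section DualFactorization

universe u

variable {Ω : Type u} [MeasurableSpace Ω] {N : (Ω → ℝ) → ℝ≥0∞}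

/-- Here ψ is the infimum hull of Φ_f and χ, the supremum hull of ψ, is exact in both senses. A
measure dominating χ^s dominates ψ^s, and d bounds its mass; c enters when N(g)^p is bounded by the
infimum hull of Φ_g. -/
theorem exists_probability_le_lambdaNorm (hN : IsAdmissibleQuasinorm N)
    {p q : ℝ} (hp : 0 < p) (hpq : p < q) {a b : ℝ≥0}
    (ha : CrudeUpperEstimate N p a) (hb : CrudeLowerEstimate N q b)
    {f : Ω → ℝ} (hf : Measurable f) (hf0 : ∀ ω, 0 ≤ f ω) (hf1 : N f = 1) :
    ∃ μ : Measure Ω, IsProbabilityMeasure μ ∧ (∀ᵐ ω ∂μ, 0 < f ω) ∧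
      ∀ g : Ω → ℝ, Measurable g → N g < ∞ → N ({ω | f ω = 0}.indicator g) = 0 →
        N g ≤ a * b * ENNReal.ofReal (kConst (p / q) ^ (1 / q))
          * lambdaNorm q p μ (fun ω => g ω / f ω) := by
  have hq : 0 < q := hp.trans hpq
  have hfN : N f < ∞ := hf1 ▸ ENNReal.one_lt_top
  set s := q / p with hsdef
  have hs : 1 ≤ s := (one_le_div hp).2 hpq.le
  have hs0 : 0 < s := by linarith
  have hs1 : p / q = 1 / s := by rw [hsdef, one_div_div]
  rw [hs1]
  set c : ℝ≥0∞ := (a : ℝ≥0∞) ^ p with hc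
  set d : ℝ≥0∞ := (b : ℝ≥0∞) ^ p with hd
  have hctop : c ≠ ∞ := ENNReal.rpow_ne_top_of_nonneg hp.le ENNReal.coe_ne_top
  have hdtop : d ≠ ∞ := ENNReal.rpow_ne_top_of_nonneg hp.le ENNReal.coe_ne_top
  set Φ : (Ω → ℝ) → Set Ω → ℝ≥0∞ := fun g A => N (A.indicator g) ^ p with hΦ
  have hΦuniv : Φ f univ = 1 := by simp [hΦ, hf1]
  have hΦsub : ∀ g, Measurable g → N g < ∞ → CrudelySubadditive c (Φ g) :=
    fun g hg hgN => ha.crudelySubadditive hN hp hg hgN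
  have hΦsup : CrudelySuperadditive s d (Φ f) := hb.crudelySuperadditive hN hp hq hf hfN
  have hc0 : c ≠ 0 := by
    rintro h
    have := (hΦsub f hf hfN).le (IsPartitionOf.unit MeasurableSet.univ)
    simp [hΦuniv, h] at this
  have hd0 : d ≠ 0 := by
    rintro h
    have := hΦsup.le (IsPartitionOf.unit MeasurableSet.univ)
    simp [hΦuniv, h] at this
  have hΦempty : ∀ g, Φ g ∅ = 0 := fun g => by
    simp only [hΦ, indicator_empty]
    rw [hN.zero, ENNReal.zero_rpow_of_pos hp]
  set ψ : Set Ω → ℝ≥0∞ := infHull (Φ f) with hψ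
  have hψsub : CrudelySubadditive 1 ψ := crudelySubadditive_infHull (hΦempty f)
  have hψsup : CrudelySuperadditive s d ψ := hΦsup.infHull hs hd0 hdtop
  have hψΦ : ∀ A, MeasurableSet A → ψ A ≤ Φ f A := fun A hA => infHull_le_self _ hA
  have hΦψ : ∀ A, Φ f A ≤ c * ψ A := (hΦsub f hf hfN).le_mul_infHull hc0 hctop
  set χ : Set Ω → ℝ≥0∞ := fun B => supHull (fun A => ψ A ^ s) B ^ (1 / s) with hχ
  have hχs : ∀ A, χ A ^ s = supHull (fun A => ψ A ^ s) A := fun A => by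
    rw [hχ]; dsimp only; rw [one_div, ENNReal.rpow_inv_rpow hs0.ne']
  have hχsub : CrudelySubadditive 1 χ := hψsub.supHull hs
  have hχsup : CrudelySuperadditive s 1 χ := crudelySuperadditive_supHull hs0 _
  have hχuniv : χ univ ^ s ≤ d ^ s := by
    rw [hχs]
    refine (hψsup.supHull_le hs0 univ).trans (ENNReal.rpow_le_rpow ?_ hs0.le)
    calc d * ψ univ ≤ d * 1 := by gcongr; exact (hψΦ _ .univ).trans_eq hΦuniv
      _ = d := mul_one d
  have hχfin : χ univ ≠ ∞ :=
    ne_top_of_le_ne_top hdtop ((ENNReal.rpow_le_rpow_iff hs0).1 hχuniv)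
  obtain ⟨m, hm, hmle, hmK⟩ := exists_le_isFinitelyAdditive hs hχfin hχsub hχsup
  obtain ⟨μ₀, hμm, hμ⟩ := hm.exists_measure_le
  have hψm : ∀ A, MeasurableSet A → ψ A ^ s ≤ m A := fun A hA =>
    (le_supHull_self (fun A => ψ A ^ s) hA).trans ((hχs A).symm.trans_le (hmle A hA))
  -- For T_n increasing to A, ψ(A) ≤ ψ(T_n) + Φ_f(A \ T_n), where ψ(T_n)^s ≤ m(T_n) and the last
  -- term is removed by order continuity.
  have hψμ : ∀ A, MeasurableSet A → ψ A ^ s ≤ μ₀ A := by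
    intro A hA
    refine hμ A hA _ fun T hT hTmono hTA => ?_
    rw [← ENNReal.le_rpow_inv_iff hs0]
    refine le_of_forall_le_add_indicator hN hp hs0 hdtop one_ne_zero
      ENNReal.one_ne_top hf hf0 hfN hΦsup
      (B := fun n => A \ T n) (fun n => hA.diff (hT n)) (fun i j hij => sdiff_subset_sdiff_right
        (hTmono hij)) (by rw [← sdiff_iUnion, hTA, sdiff_self]) fun n => ?_
    have hTnA : T n ⊆ A := hTA ▸ subset_iUnion T n
    have h1 := hψsub.union_le (hT n) (hA.diff (hT n)) disjoint_sdiff_right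
    rw [union_sdiff_cancel hTnA] at h1
    rw [one_mul]
    refine h1.trans (add_le_add ?_ (hψΦ _ (hA.diff (hT n))))
    rw [ENNReal.le_rpow_inv_iff hs0]
    exact (hψm _ (hT n)).trans (le_iSup (fun n => m (T n)) n)
  -- Unlike in part (i), domination from above need not make {f = 0} null, so the measure is
  -- restricted to P. Its mass there is positive because 1 = Φ_f(P) ≤ c ψ(P).
  set P : Set Ω := {ω | f ω = 0}ᶜ with hP
  have hPm : MeasurableSet P := (measurableSet_zero hf).compl
  have hPpos : ∀ ω ∈ P, 0 < f ω := fun ω hω => lt_of_le_of_ne (hf0 ω) (Ne.symm hω)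
  set M := μ₀ P with hM
  set K : ℝ≥0∞ := ENNReal.ofReal (kConst (1 / s)) with hK
  have hr0 : 0 < 1 / s := by positivity
  have hK0 : K ≠ 0 := (ENNReal.ofReal_pos.2 (kConst_pos hr0)).ne'
  have hKtop : K ≠ ∞ := ENNReal.ofReal_ne_top
  have hMle : M ≤ K * d ^ s :=
    (measure_mono (subset_univ P)).trans ((hμm _ .univ).trans (hmK.trans (by gcongr)))
  have hMtop : M ≠ ∞ := ne_top_of_le_ne_top
    (ENNReal.mul_ne_top hKtop (ENNReal.rpow_ne_top_of_nonneg hs0.le hdtop)) hMle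
  have hM0 : M ≠ 0 := by
    intro h
    have h1 : ψ P = 0 := by
      have := hψμ P hPm
      rw [← hM, h] at this
      exact (ENNReal.rpow_eq_zero_iff_of_pos hs0).1 (le_antisymm this bot_le)
    have h2 : Φ f P = 1 := by
      have : P.indicator f = f := by
        rw [indicator_eq_self]
        exact fun ω hω => hω
      simp only [hΦ, this, hf1, ENNReal.one_rpow]
    have h3 := hΦψ P
    rw [h1, h2, mul_zero] at h3
    exact absurd h3 (by simp)
  refine ⟨M⁻¹ • μ₀.restrict P, ⟨by simp [← hM, ENNReal.inv_mul_cancel hM0 hMtop]⟩, ?_,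
    fun g hg hgN hg0 => ?_⟩
  · rw [ae_iff, Measure.smul_apply, smul_eq_mul]
    have e : {ω | ¬0 < f ω} = Pᶜ := by
      rw [hP, compl_compl]
      ext ω; exact ⟨fun h => le_antisymm (not_lt.1 h) (hf0 ω), fun h => h.not_gt⟩
    rw [e, Measure.restrict_apply hPm.compl, compl_inter_self, measure_empty, mul_zero]
  · set ν := M⁻¹ • μ₀.restrict P with hν
    have hψν : ∀ A, MeasurableSet A → ψ (A ∩ P) ≤ (K * d ^ s * ν A) ^ (1 / s) := by
      intro A hA
      rw [one_div, ENNReal.le_rpow_inv_iff hs0]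
      refine (hψμ _ (hA.inter hPm)).trans ?_
      have : μ₀ (A ∩ P) = M * ν A := by
        rw [hν, Measure.smul_apply, smul_eq_mul, Measure.restrict_apply hA, ← mul_assoc,
          ENNReal.mul_inv_cancel hM0 hMtop, one_mul]
      rw [this]
      gcongr
    set C : ℝ≥0∞ := a * b * ENNReal.ofReal (kConst (1 / s) ^ (1 / q)) with hC
    have hCeq : C = (c * (K * d ^ s) ^ (1 / s)) ^ (1 / p) := by
      have hp' : (0 : ℝ) ≤ 1 / p := by positivity
      rw [ENNReal.mul_rpow_of_nonneg _ _ hp', ENNReal.mul_rpow_of_nonneg _ _ hr0.le,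
        ENNReal.mul_rpow_of_nonneg _ _ hp', ← ENNReal.rpow_mul K,
        one_div s, ENNReal.rpow_rpow_inv hs0.ne', hc, hd, one_div p,
        ENNReal.rpow_rpow_inv hp.ne', ENNReal.rpow_rpow_inv hp.ne', ← one_div s, hC,
        ← ENNReal.ofReal_rpow_of_pos (kConst_pos hr0)]
      have : 1 / s * p⁻¹ = 1 / q := by rw [hsdef]; field_simp
      rw [this]
      ring
    have hC0 : C ≠ 0 := by
      rw [hCeq]
      refine (ENNReal.rpow_pos (pos_iff_ne_zero.2 (mul_ne_zero hc0 ?_)) ?_).ne'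
      · refine (ENNReal.rpow_pos (pos_iff_ne_zero.2 (mul_ne_zero hK0 ?_)) ?_).ne'
        · exact (ENNReal.rpow_pos (pos_iff_ne_zero.2 hd0) hdtop).ne'
        · exact ENNReal.mul_ne_top hKtop (ENNReal.rpow_ne_top_of_nonneg hs0.le hdtop)
      · exact ENNReal.mul_ne_top hctop (ENNReal.rpow_ne_top_of_nonneg hr0.le
          (ENNReal.mul_ne_top hKtop (ENNReal.rpow_ne_top_of_nonneg hs0.le hdtop)))
    have hCtop : C ≠ ∞ := ENNReal.mul_ne_top (ENNReal.mul_ne_top ENNReal.coe_ne_top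
      ENNReal.coe_ne_top) ENNReal.ofReal_ne_top
    -- C is moved across so that the infimum can be tested on one partition at a time; this needs 0
    -- < C < ∞.
    rw [lambdaNorm, if_neg hpq.not_gt, mul_comm, ← ENNReal.div_le_iff hC0 hCtop, hs1]
    refine le_iInf₂ fun n A => le_iInf fun hA => ?_
    rw [ENNReal.div_le_iff hC0 hCtop, mul_comm]
    have hA' := hA.isPartitionOf
    have hterm : ∀ i, infHull (Φ g) (A i ∩ P) ≤ (K * d ^ s) ^ (1 / s) *
        ((⨆ ω ∈ A i, ENNReal.ofReal |g ω / f ω|) ^ p * ν (A i) ^ (1 / s)) := by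
      intro i
      have hAi := hA.measurableSet i
      have hAP := hAi.inter hPm
      set t := ⨆ ω ∈ A i, ENNReal.ofReal |g ω / f ω| with ht
      have h1 : infHull (Φ g) (A i ∩ P) ≤ t ^ p * ψ (A i ∩ P) := by
        -- If |g/f| is unbounded on A_i, the right side can be finite only when ψ vanishes on A_i ∩
        -- P; then f 1_{A_i ∩ P}, and hence g 1_{A_i ∩ P}, has quasinorm zero.
        by_cases htop : t = ∞
        · rw [htop, ENNReal.top_rpow_of_pos hp]
          by_cases h0 : ψ (A i ∩ P) = 0
          · rw [h0, mul_zero]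
            have h2 := hΦψ (A i ∩ P)
            rw [h0, mul_zero] at h2
            have h3 := (ENNReal.rpow_eq_zero_iff_of_pos hp).1 (le_antisymm h2 bot_le)
            have h4 := hN.indicator_eq_zero hf hg hf0 hAP (fun ω hω => hPpos ω hω.2) h3
            refine (infHull_le_self _ hAP).trans_eq ?_
            simp only [hΦ, h4, ENNReal.zero_rpow_of_pos hp]
          · rw [ENNReal.top_mul h0]
            exact le_top
        · refine infHull_le_mul (ENNReal.rpow_ne_top_of_nonneg hp.le htop) hAP
            fun B hB hBm => ?_
          simp only [hΦ]
          rw [← ENNReal.mul_rpow_of_nonneg _ _ hp.le]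
          exact ENNReal.rpow_le_rpow (indicator_le_iSup_mul hN hf hg hf0
            (hB.trans inter_subset_left) hBm (fun ω hω => hPpos ω (hB hω).2) htop) hp.le
      calc _ ≤ t ^ p * ψ (A i ∩ P) := h1
        _ ≤ t ^ p * (K * d ^ s * ν (A i)) ^ (1 / s) := by gcongr; exact hψν _ hAi
        _ = _ := by rw [ENNReal.mul_rpow_of_nonneg _ _ hr0.le]; ring
    have hsum : N g ^ p ≤ c * ((K * d ^ s) ^ (1 / s) *
        ∑ i, (⨆ ω ∈ A i, ENNReal.ofReal |g ω / f ω|) ^ p * ν (A i) ^ (1 / s)) := by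
      have h1 : N g ^ p ≤ c * infHull (Φ g) univ := by
        have := (hΦsub g hg hgN).le_mul_infHull hc0 hctop univ
        simpa [hΦ] using this
      have h2 : infHull (Φ g) univ ≤ infHull (Φ g) Pᶜ + infHull (Φ g) P := by
        have := infHull_union_le (Φ g) (disjoint_compl_left (a := P))
        rwa [compl_union_self] at this
      have h3 : infHull (Φ g) Pᶜ = 0 := by
        refine le_antisymm ((infHull_le_self _ hPm.compl).trans_eq ?_) bot_le
        simp only [hΦ, hP, compl_compl, hg0, ENNReal.zero_rpow_of_pos hp]
      rw [h3, zero_add] at h2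
      refine h1.trans (mul_le_mul_right ?_ c)
      refine h2.trans ((infHull_le_sum_infHull (Φ g) (hΦempty g)
        (hA'.inter hPm (subset_univ P))).trans ?_)
      rw [Finset.mul_sum]
      exact Finset.sum_le_sum fun i _ => hterm i
    rw [hCeq, ← ENNReal.mul_rpow_of_nonneg _ _ (by positivity : (0 : ℝ) ≤ 1 / p), one_div p,
      ENNReal.le_rpow_inv_iff hp, mul_assoc]
    exact hsum

end DualFactorization

theorem proposition3p5 {Ω : Type*} [TopologicalSpace Ω] [CompactSpace Ω] [T2Space Ω]
    [MeasurableSpace Ω] [BorelSpace Ω]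
    (N : (Ω → ℝ) → ℝ≥0∞) (hN : IsAdmissibleQuasinorm N)
    (p q : ℝ) (hp : 0 < p) (hpq : p < q) (a b : ℝ≥0)
    (ha : CrudeUpperEstimate N p a) (hb : CrudeLowerEstimate N q b)
    (f : Ω → ℝ) (hf : Measurable f) (hf0 : ∀ ω, 0 ≤ f ω) (hf1 : N f = 1) :
    (∃ μ : Measure Ω, IsProbabilityMeasure μ ∧ (∀ᵐ ω ∂μ, 0 < f ω) ∧
      ∀ g : Ω → ℝ, Measurable g → N g < ∞ →
        lambdaNorm p q μ (fun ω => g ω / f ω)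
          ≤ a * b * ENNReal.ofReal (kConst (q / p) ^ (-(1 / p))) * N g) ∧
    (∃ μ : Measure Ω, IsProbabilityMeasure μ ∧ (∀ᵐ ω ∂μ, 0 < f ω) ∧
      ∀ g : Ω → ℝ, Measurable g → N g < ∞ → N ({ω | f ω = 0}.indicator g) = 0 →
        N g ≤ a * b * ENNReal.ofReal (kConst (p / q) ^ (1 / q))
          * lambdaNorm q p μ (fun ω => g ω / f ω)) := by
  exact ⟨exists_probability_lambdaNorm_le hN hp hpq ha hb hf hf0 hf1,
    exists_probability_le_lambdaNorm hN hp hpq ha hb hf hf0 hf1⟩
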